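/- Let $q$ be a power of a prime $p$, let $\mathbb F_q$ be the field with $q$ elements, and let $\operatorname{tr}$ be the trace from $\mathbb F_q$ to $\mathbb F_p$. On $\mathcal H_n=(\mathbb C^q)^{\otimes n}=\mathbb C^{q^n}$, with orthonormal basis $\{|x\rangle : x\in\mathbb F_q^n\}$, let $X_a|x\rangle=|x+a\rangle$ and $Z_b|x\rangle=\omega^{\operatorname{tr}(b\cdot x)}|x\rangle$, where $a,b\in\mathbb F_q^n$ and $\omega=e^{2\pi i/p}$. The errors are the operators $\omega^cX_aZ_b$ with $c\in\mathbb F_p$; the weight of such an error is the number of indices $i$ with $(a_i,b_i)\neq(0,0)$. An $((n,K,R,\ge d))_q$ subsystem code is a subspace $Q=A\otimes B$ of $\mathcal H_n$ with $\dim A=K\ge 1$, $\dim B=R\ge 1$ such that, with $P$ the orthogonal projector onto $Q$, for every error $e$ of weight less than $d$ the operator $PeP$ restricted to $Q$ is of the form $1_A\otimes M$ for some operator $M$ on $B$. It is a Clifford subsystem code if there is an additive subgroup $X\neq\{0\}$ of $\mathbb F_q^{2n}$ such that the group $N$ of all errors $\omega^cX_aZ_b$ with $(a|b)\in X$ acts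 on $Q=A\otimes B$ as $1_A\otimes\sigma$ for an irreducible representation $\sigma$ of $N$ on $B$, and $Q$ is the whole $\sigma$-isotypic component of $\mathcal H_n$. An $((n,K,\ge d))_q$ stabilizer code is a $K$-dimensional subspace $Q\neq 0$ of $\mathcal H_n$ that is a joint eigenspace of an abelian group of errors (one prescribed eigenvalue for each element of the group) and for which $PeP$ is a scalar multiple of $P$ for every error $e$ of weight less than $d$, where $P$ is the orthogonal projector onto $Q$. **Theorem.** Let $n,r,d$ be integers with $0<r<n$ and $d\ge 1$, and let $k$ be a real number such that $q^k$ is a power of $p$ and $1<q^k\le q^n$. If $d=1$, assume in addition that $k+r\le n$. Suppose that $$\sum_{j=1}^{d-1}\binom nj (q^2-1)^j\,\bigl(q^{n+k+r}-q^{n+r-k}\bigr)<(p-1)(q^{2n}-1).$$ Then there exist both an $((n,q^k,q^r,\ge d))_q$ Clifford subsystem code and an $((n-r,q^k,\ge d))_q$ stabilizer code. -/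

import Mathlib

open scoped TensorProduct InnerProductSpace

noncomputable section

namespace SubsystemCode

/-- The state space `ℂ^q ⊗ ⋯ ⊗ ℂ^q = ℂ^(q^n)` of `n` qudits, with orthonormal basis `|x⟩`
indexed by `x ∈ F^n`, where `F` is the field with `q` elements. -/
abbrev Qudits (F : Type*) [Fintype F] (n : ℕ) : Type _ := EuclideanSpace ℂ (Fin n → F)

/-- The space `F^(2n)` of pairs `(a|b)`. -/
abbrev Phase (F : Type*) (n : ℕ) : Type _ := (Fin n → F) × (Fin n → F)

/-- The phase `ω^(tr z)`, with `ω = exp(2πi/p)` and `tr` the trace of `F` over its prime field. -/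
def omegaTr (p : ℕ) [NeZero p] {F : Type*} [Field F] [Algebra (ZMod p) F] (z : F) : ℂ :=
  ZMod.stdAddChar (Algebra.trace (ZMod p) F z)

section Errors

variable (p : ℕ) [NeZero p] {F : Type*} [Field F] [Fintype F] [Algebra (ZMod p) F] {n : ℕ}

/-- The shift operator `X_a = X_{a_1} ⊗ ⋯ ⊗ X_{a_n}`, given by `X_a |x⟩ = |x + a⟩`. -/
def shiftOp (a : Fin n → F) : Qudits F n →ₗ[ℂ] Qudits F n where
  toFun v := WithLp.toLp 2 fun x => v (x - a)
  map_add' _ _ := rfl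
  map_smul' _ _ := rfl

/-- The phase operator `Z_b = Z_{b_1} ⊗ ⋯ ⊗ Z_{b_n}`, given by
`Z_b |x⟩ = ω^(tr(b_1 x_1)) ⋯ ω^(tr(b_n x_n)) |x⟩`. -/
def phaseOp (b : Fin n → F) : Qudits F n →ₗ[ℂ] Qudits F n where
  toFun v := WithLp.toLp 2 fun x => (∏ i, omegaTr p (b i * x i)) * v x
  map_add' u v := by ext x; simp [mul_add]
  map_smul' c v := by ext x; simp [mul_left_comm]

theorem shiftOp_single [DecidableEq F] (a x : Fin n → F) :
    shiftOp a (EuclideanSpace.single x (1 : ℂ)) = EuclideanSpace.single (x + a) (1 : ℂ) := by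
  ext y
  change (EuclideanSpace.single x (1 : ℂ)) (y - a) = _
  simp [sub_eq_iff_eq_add]

theorem phaseOp_single [DecidableEq F] (b x : Fin n → F) :
    phaseOp p b (EuclideanSpace.single x (1 : ℂ)) =
      (∏ i, omegaTr p (b i * x i)) • EuclideanSpace.single x (1 : ℂ) := by
  ext y
  by_cases h : y = x
  · subst h; simp [phaseOp]
  · simp [phaseOp, h]

/-- The operator `X_{a_1} Z_{b_1} ⊗ ⋯ ⊗ X_{a_n} Z_{b_n}` for `w = (a|b)`. -/
def pauliOp (w : Phase F n) : Qudits F n →ₗ[ℂ] Qudits F n :=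
  shiftOp w.1 ∘ₗ phaseOp p w.2

/-- The general element `ω^c X_{a_1} Z_{b_1} ⊗ ⋯ ⊗ X_{a_n} Z_{b_n}` of the error group. -/
def errorOp (c : ZMod p) (w : Phase F n) : Qudits F n →ₗ[ℂ] Qudits F n :=
  (ZMod.stdAddChar c : ℂ) • pauliOp p w

end Errors

open Classical in
/-- The symplectic weight of `w = (a|b)`: the number of `i` with `(a_i, b_i) ≠ (0, 0)`. It is the
number of qudits on which the errors `errorOp p c w` act nontrivially. -/
def swt {F : Type*} [Field F] {n : ℕ} (w : Phase F n) : ℕ :=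
  (Finset.univ.filter fun i => (w.1 i, w.2 i) ≠ (0, 0)).card

/-- The tensor product `A ⊗ B` of a subsystem `A = ℂ^K` and a co-subsystem `B = ℂ^R`. -/
abbrev Bipartite (K R : ℕ) : Type :=
  EuclideanSpace ℂ (Fin K) ⊗[ℂ] EuclideanSpace ℂ (Fin R)

/-- A subsystem code on `n` qudits with subsystem `A` of dimension `K` and co-subsystem `B` of
dimension `R`: a subspace `Q` of the state space together with an identification
`A ⊗ B ≅ Q` of Hilbert spaces, that is, an isometric embedding of `A ⊗ B` with range `Q`. -/
structure Code (F : Type*) [Fintype F] (n K R : ℕ) where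
  dim_pos : 0 < K ∧ 0 < R
  embed : Bipartite K R →ₗᵢ[ℂ] Qudits F n

section Codes

variable (p : ℕ) [NeZero p] {F : Type*} [Field F] [Fintype F] [Algebra (ZMod p) F] {n : ℕ}

/-- The operator `e` is detectable on the subsystem `A` of `Q = A ⊗ B`: the compression `P e P`
to `Q` is of the form `1 ⊗ M`, so it acts on the co-subsystem `B` only. -/
def Code.Detects {K R : ℕ} (Q : Code F n K R) (e : Qudits F n →ₗ[ℂ] Qudits F n) : Prop :=
  ∃ M : EuclideanSpace ℂ (Fin R) →ₗ[ℂ] EuclideanSpace ℂ (Fin R),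
    ∀ x y : Bipartite K R,
      ⟪Q.embed x, e (Q.embed y)⟫_ℂ = ⟪x, TensorProduct.map LinearMap.id M y⟫_ℂ

/-- The subsystem `A` has minimum distance at least `d`: all errors of weight less than `d` in the
error group are detectable on `A`. -/
def Code.MinDistGE {K R : ℕ} (Q : Code F n K R) (d : ℕ) : Prop :=
  ∀ (c : ZMod p) (w : Phase F n), swt w < d → Q.Detects (errorOp p c w)

/-- `Q = A ⊗ B` is the Clifford subsystem code constructed from the additive code `X ≠ {0}` in
`F^(2n)`. Let `N` be the group of all errors `ω^c X_a Z_b` with `(a|b) ∈ X`. Then `N` acts on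
`Q = A ⊗ B` through an irreducible representation on `B` (given by `σ`), and `Q` is the whole
isotypic component of the state space for this representation of `N`. -/
def Code.IsCliffordOf {K R : ℕ} (Q : Code F n K R) (X : AddSubgroup (Phase F n)) : Prop :=
  X ≠ ⊥ ∧
  ∃ σ : Phase F n → (EuclideanSpace ℂ (Fin R) →ₗ[ℂ] EuclideanSpace ℂ (Fin R)),
    (∀ w ∈ X, ∀ a b, pauliOp p w (Q.embed (a ⊗ₜ[ℂ] b)) = Q.embed (a ⊗ₜ[ℂ] σ w b)) ∧
    (∀ W : Submodule ℂ (EuclideanSpace ℂ (Fin R)),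
      (∀ w ∈ X, ∀ b ∈ W, σ w b ∈ W) → W = ⊥ ∨ W = ⊤) ∧
    (∀ T : EuclideanSpace ℂ (Fin R) →ₗ[ℂ] Qudits F n,
      (∀ w ∈ X, ∀ b, pauliOp p w (T b) = T (σ w b)) →
        LinearMap.range T ≤ LinearMap.range Q.embed.toLinearMap)

/-- A Clifford subsystem code is one constructed from some nonzero additive code. -/
def Code.IsClifford {K R : ℕ} (Q : Code F n K R) : Prop :=
  ∃ X : AddSubgroup (Phase F n), Q.IsCliffordOf p X

/-- `Q` is a stabilizer code: a nonzero joint eigenspace of an abelian group of errors. The group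
is the one of all `ω^c X_a Z_b` with `(a|b) ∈ S`, and `χ` gives the eigenvalues. (If the phases
`χ⁻¹` are absorbed into the operators, `Q` is their joint eigenspace for the eigenvalue `1`; for
`p = 2` these phases may include `± i`.) -/
def IsStabilizerCode (Q : Submodule ℂ (Qudits F n)) : Prop :=
  Q ≠ ⊥ ∧
  ∃ (S : AddSubgroup (Phase F n)) (χ : Phase F n → ℂ),
    (∀ w ∈ S, ∀ w' ∈ S, Commute (pauliOp p w) (pauliOp p w')) ∧
    ∀ v : Qudits F n, v ∈ Q ↔ ∀ w ∈ S, pauliOp p w v = χ w • v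

/-- The code `Q` has minimum distance at least `d`: for all errors `e` of weight less than `d` in
the error group, the compression `P e P` to `Q` is a scalar multiple of `P`. -/
def StabilizerMinDistGE (Q : Submodule ℂ (Qudits F n)) (d : ℕ) : Prop :=
  ∀ (c : ZMod p) (w : Phase F n), swt w < d →
    ∃ μ : ℂ, ∀ u ∈ Q, ∀ v ∈ Q, ⟪u, errorOp p c w v⟫_ℂ = μ * ⟪u, v⟫_ℂ

end Codes

end SubsystemCode

end

open scoped TensorProduct InnerProductSpace

noncomputable section

set_option linter.unusedSectionVars false

namespace SubsystemCode

/-! Write E_w for `pauliOp p w`. Two errors E_w, E_w' commute up to ω^⟨w,w'⟩, with ⟨·,·⟩ the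
trace-symplectic form `sympl`, so the existence of codes becomes a question about F_p-subspaces of
F^(2n).

Take an isotropic L, a subspace T whose points are separated by pairing with L, and Z ≤ L orthogonal
to T. A joint eigenspace of L has dimension q^n/|L|. Its translates by E_t, t in T, have distinct
L-characters, so they are orthogonal and their sum is A ⊗ B with A the eigenspace and B spanned by
T. The errors in X = T ⊔ L act on B alone: L is diagonal with distinct characters and T permutes the
basis up to phases, whence irreducibility. An error of low weight is harmless if it lies in X, or if
it fails to commute with some element of Z, since Z acts on the code by scalars. The only bad
vectors are those of Z^⊥ \ X (`exists_clifford_code`). The case T = 0 gives stabilizer codes.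

It remains to find X with no bad vector of weight less than d. An explicit triple of the right size
exists (`exists_isCodeTriple`). The symplectic group over F_p is transitive on nonzero vectors, so
averaging over it shows that some image avoids the low weights. Both sets are stable under F_p^*, so
any collision brings p - 1 of them, which accounts for the factor p - 1
(`exists_symplGroup_forall_notMem`). The stabilizer code comes from the same argument at length n -
r, whose inequality follows from the given one (`gv_shorten`). -/

theorem addChar_map_sum {A M ι : Type*} [AddCommMonoid A] [CommMonoid M] (ψ : AddChar A M)
    (s : Finset ι) (f : ι → A) : ψ (∑ i ∈ s, f i) = ∏ i ∈ s, ψ (f i) := by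
  induction s using Finset.cons_induction with
  | empty => simp
  | cons i s hi ih => rw [Finset.sum_cons, Finset.prod_cons, AddChar.map_add_eq_mul, ih]

/-! ### The trace-symplectic form and the commutation of errors -/

section Pauli

variable (p : ℕ) [Fact p.Prime] {F : Type*} [Field F] [Fintype F] [Algebra (ZMod p) F] {n : ℕ}

/-- The trace form `(a, b) ↦ tr (a · b)` on `F^n`. -/
def traceDot : LinearMap.BilinForm (ZMod p) (Fin n → F) :=
  LinearMap.mk₂ (ZMod p) (fun a b => Algebra.trace (ZMod p) F (a ⬝ᵥ b))
    (fun a a' b => by rw [add_dotProduct, map_add])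
    (fun c a b => by rw [smul_dotProduct, map_smul])
    (fun a b b' => by rw [dotProduct_add, map_add])
    (fun c a b => by rw [dotProduct_smul, map_smul])

theorem traceDot_apply (a b : Fin n → F) :
    traceDot p a b = Algebra.trace (ZMod p) F (a ⬝ᵥ b) := rfl

theorem traceDot_comm (a b : Fin n → F) : traceDot p a b = traceDot p b a := by
  rw [traceDot_apply, traceDot_apply, dotProduct_comm]

theorem exists_traceDot_ne_zero {a : Fin n → F} (ha : a ≠ 0) : ∃ b, traceDot p a b ≠ 0 := by
  obtain ⟨i, hi⟩ := Function.ne_iff.mp ha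
  by_contra! h
  refine hi ((traceForm_nondegenerate (ZMod p) F).1 (a i) fun z => ?_)
  have := h (Pi.single i z)
  rwa [traceDot_apply, dotProduct_single] at this

theorem traceDot_nondegenerate :
    (traceDot p : LinearMap.BilinForm (ZMod p) (Fin n → F)).Nondegenerate := by
  refine ⟨fun a h => ?_, fun a h => ?_⟩ <;> by_contra ha
  · obtain ⟨b, hb⟩ := exists_traceDot_ne_zero p ha
    exact hb (h b)
  · obtain ⟨b, hb⟩ := exists_traceDot_ne_zero p ha
    exact hb ((traceDot_comm p a b).trans (h b))

/-- The trace-symplectic form on `F^(2n)`. -/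
def sympl : LinearMap.BilinForm (ZMod p) (Phase F n) :=
  LinearMap.mk₂ (ZMod p) (fun w w' => traceDot p w.2 w'.1 - traceDot p w.1 w'.2)
    (fun w w' v => by simp only [Prod.fst_add, Prod.snd_add, map_add, LinearMap.add_apply]; ring)
    (fun c w v => by
      simp only [Prod.smul_fst, Prod.smul_snd, map_smul, LinearMap.smul_apply, smul_sub])
    (fun w v v' => by simp only [Prod.fst_add, Prod.snd_add, map_add]; ring)
    (fun c w v => by simp only [Prod.smul_fst, Prod.smul_snd, map_smul, smul_sub])

theorem sympl_apply (w w' : Phase F n) :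
    sympl p w w' = traceDot p w.2 w'.1 - traceDot p w.1 w'.2 := rfl

theorem sympl_self (w : Phase F n) : sympl p w w = 0 := by
  rw [sympl_apply, traceDot_comm, sub_self]

theorem sympl_swap (w w' : Phase F n) : sympl p w w' = -sympl p w' w := by
  rw [sympl_apply, sympl_apply, traceDot_comm p w.2, traceDot_comm p w.1]; ring

theorem sympl_eq_zero_comm {w w' : Phase F n} : sympl p w w' = 0 ↔ sympl p w' w = 0 := by
  rw [sympl_swap, neg_eq_zero]

theorem exists_sympl_ne_zero {w : Phase F n} (hw : w ≠ 0) : ∃ w', sympl p w w' ≠ 0 := by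
  by_cases h : w.1 = 0
  · have h2 : w.2 ≠ 0 := fun h2 => hw (Prod.ext h h2)
    obtain ⟨b, hb⟩ := exists_traceDot_ne_zero p h2
    exact ⟨(b, 0), by simpa [sympl_apply] using hb⟩
  · obtain ⟨b, hb⟩ := exists_traceDot_ne_zero p h
    exact ⟨(0, b), by simpa [sympl_apply] using hb⟩

theorem stdAddChar_ne_zero (z : ZMod p) : (ZMod.stdAddChar z : ℂ) ≠ 0 := by
  rw [ZMod.stdAddChar_apply]; exact Circle.coe_ne_zero _

theorem conj_stdAddChar_mul_self (z : ZMod p) :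
    (starRingEnd ℂ) (ZMod.stdAddChar z) * ZMod.stdAddChar z = 1 := by
  rw [ZMod.stdAddChar_apply, Complex.conj_mul', Circle.norm_coe]; simp

theorem stdAddChar_eq_one_iff {z : ZMod p} : (ZMod.stdAddChar z : ℂ) = 1 ↔ z = 0 := by
  rw [← (ZMod.stdAddChar (N := p)).map_zero_eq_one, ZMod.injective_stdAddChar.eq_iff]

theorem shiftOp_apply (a : Fin n → F) (v : Qudits F n) (x : Fin n → F) :
    shiftOp a v x = v (x - a) := rfl

theorem phaseOp_apply (b : Fin n → F) (v : Qudits F n) (x : Fin n → F) :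
    phaseOp p b v x = ZMod.stdAddChar (traceDot p b x) * v x := by
  change (∏ i, omegaTr p (b i * x i)) * v x = _
  congr 1
  simp only [omegaTr, traceDot_apply, dotProduct, map_sum]
  exact (addChar_map_sum _ _ _).symm

theorem pauliOp_apply (w : Phase F n) (v : Qudits F n) (x : Fin n → F) :
    pauliOp p w v x = ZMod.stdAddChar (traceDot p w.2 (x - w.1)) * v (x - w.1) := by
  rw [pauliOp, LinearMap.comp_apply, shiftOp_apply, phaseOp_apply]

theorem pauliOp_zero_apply (v : Qudits F n) : pauliOp p (0 : Phase F n) v = v := by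
  ext x; simp [pauliOp_apply]

theorem pauliOp_zero : pauliOp p (0 : Phase F n) = LinearMap.id :=
  LinearMap.ext (pauliOp_zero_apply p)

theorem pauliOp_pauliOp (w w' : Phase F n) (v : Qudits F n) :
    pauliOp p w (pauliOp p w' v) =
      (ZMod.stdAddChar (traceDot p w.2 w'.1) : ℂ) • pauliOp p (w + w') v := by
  ext x
  rw [PiLp.smul_apply, smul_eq_mul]
  simp only [pauliOp_apply, Prod.fst_add, Prod.snd_add]
  rw [sub_sub, ← mul_assoc, ← mul_assoc, ← AddChar.map_add_eq_mul, ← AddChar.map_add_eq_mul]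
  congr 2
  simp only [map_add, map_sub, LinearMap.add_apply]
  ring

theorem pauliOp_comm (w w' : Phase F n) (v : Qudits F n) :
    pauliOp p w (pauliOp p w' v) =
      (ZMod.stdAddChar (sympl p w w') : ℂ) • pauliOp p w' (pauliOp p w v) := by
  rw [pauliOp_pauliOp, pauliOp_pauliOp, smul_smul, ← AddChar.map_add_eq_mul, add_comm w' w,
    sympl_apply, traceDot_comm p w.1, sub_add_cancel]

theorem pauliOp_commute {w w' : Phase F n} (h : sympl p w w' = 0) :
    Commute (pauliOp p w) (pauliOp p w') :=
  LinearMap.ext fun v => by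
    rw [Module.End.mul_apply, pauliOp_comm, h, AddChar.map_zero_eq_one, one_smul]; rfl

theorem inner_pauliOp_pauliOp (w : Phase F n) (u v : Qudits F n) :
    ⟪pauliOp p w u, pauliOp p w v⟫_ℂ = ⟪u, v⟫_ℂ := by
  simp only [PiLp.inner_apply, pauliOp_apply]
  rw [← Equiv.sum_comp (Equiv.subRight w.1) (fun x => ⟪u x, v x⟫_ℂ)]
  refine Finset.sum_congr rfl fun x _ => ?_
  simp only [RCLike.inner_apply, map_mul, Equiv.subRight_apply]
  linear_combination (v (x - w.1) * (starRingEnd ℂ) (u (x - w.1))) *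
    conj_stdAddChar_mul_self p (traceDot p w.2 (x - w.1))

theorem pauliOp_injective (w : Phase F n) : Function.Injective (pauliOp p w) := by
  refine (injective_iff_map_eq_zero _).2 fun v hv => ?_
  rw [← inner_self_eq_zero (𝕜 := ℂ), ← inner_pauliOp_pauliOp p w, hv, inner_zero_left]

/-- Conjugating by an error that does not commute with `pauliOp p w` multiplies it by a root of
unity other than 1, while the trace is unchanged. -/
theorem trace_pauliOp_eq_zero {w : Phase F n} (hw : w ≠ 0) :
    LinearMap.trace ℂ _ (pauliOp p w) = 0 := by
  obtain ⟨w', hw'⟩ := exists_sympl_ne_zero p hw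
  set e := LinearEquiv.ofInjectiveEndo (pauliOp p w') (pauliOp_injective p w')
  have h : e.symm.conj (pauliOp p w) = (ZMod.stdAddChar (sympl p w w') : ℂ) • pauliOp p w := by
    ext1 v
    rw [LinearEquiv.conj_apply_apply, LinearEquiv.symm_symm, LinearEquiv.symm_apply_eq]
    change pauliOp p w (pauliOp p w' v) = pauliOp p w' _
    rw [pauliOp_comm, LinearMap.smul_apply, map_smul]
  have h2 := LinearMap.trace_conj' (pauliOp p w) e.symm
  rw [h, map_smul, smul_eq_mul] at h2
  by_contra h0
  exact hw' ((stdAddChar_eq_one_iff p).1 (mul_right_cancel₀ h0 (h2.trans (one_mul _).symm)))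

end Pauli

/-! ### Joint eigenspaces of isotropic subspaces -/

section Eigenspace

variable (p : ℕ) [Fact p.Prime] {F : Type*} [Field F] [Fintype F] [Algebra (ZMod p) F] {n : ℕ}

/-- The joint eigenspace of the errors in `L` with eigenvalues `χ`. -/
def jointEigenspace (L : Submodule (ZMod p) (Phase F n)) (χ : Phase F n → ℂ) :
    Submodule ℂ (Qudits F n) where
  carrier := {v | ∀ w ∈ L, pauliOp p w v = χ w • v}
  add_mem' hu hv w hw := by rw [map_add, hu w hw, hv w hw, smul_add]
  zero_mem' w _ := by rw [map_zero, smul_zero]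
  smul_mem' c v hv w hw := by rw [map_smul, hv w hw, smul_comm]

variable {p}

/-- `L` is isotropic for the trace-symplectic form. -/
def Isotropic (L : Submodule (ZMod p) (Phase F n)) : Prop :=
  ∀ w ∈ L, ∀ w' ∈ L, sympl p w w' = 0

/-- Isotropic families of errors have a joint eigenvector. -/
theorem Isotropic.exists_jointEigenspace_ne_bot {L : Submodule (ZMod p) (Phase F n)}
    (hL : Isotropic L) : ∃ χ : Phase F n → ℂ, jointEigenspace p L χ ≠ ⊥ := by
  let S : Set (Submodule ℂ (Qudits F n)) :=
    {W | W ≠ ⊥ ∧ ∀ w ∈ L, ∀ v ∈ W, pauliOp p w v ∈ W}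
  have hS : S.Nonempty := ⟨⊤, top_ne_bot, fun _ _ _ _ => Submodule.mem_top⟩
  -- On a minimal nonzero invariant subspace every error of L is a scalar: its eigenspaces are again
  -- invariant, because L is commutative.
  obtain ⟨W, ⟨hW0, hW⟩, hmin⟩ := WellFounded.has_min wellFounded_lt S hS
  have key : ∀ w ∈ L, ∃ c : ℂ, ∀ v ∈ W, pauliOp p w v = c • v := by
    intro w hw
    have : Nontrivial W := Submodule.nontrivial_iff_ne_bot.2 hW0
    obtain ⟨c, hc⟩ := Module.End.exists_eigenvalue ((pauliOp p w).restrict (hW w hw))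
    obtain ⟨⟨u, huW⟩, hu⟩ := hc.exists_hasEigenvector
    have hu1 : pauliOp p w u = c • u := congrArg Subtype.val hu.apply_eq_smul
    have hu0 : u ≠ 0 := fun h => hu.2 (Subtype.ext h)
    refine ⟨c, fun v hv => ?_⟩
    let W' : Submodule ℂ (Qudits F n) := W ⊓ LinearMap.ker (pauliOp p w - c • LinearMap.id)
    have hmem : ∀ v, v ∈ W' ↔ v ∈ W ∧ pauliOp p w v = c • v := fun v => by
      simp [W', sub_eq_zero]
    have hW' : W' ∈ S := by
      refine ⟨fun h => hu0 ?_, fun l hl x hx => ?_⟩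
      · have : u ∈ W' := (hmem u).2 ⟨huW, hu1⟩
        rwa [h, Submodule.mem_bot] at this
      · rw [hmem] at hx ⊢
        refine ⟨hW l hl x hx.1, ?_⟩
        rw [pauliOp_comm, hL w hw l hl, AddChar.map_zero_eq_one, one_smul, hx.2, map_smul]
    have hle : W ≤ W' := by
      by_contra h
      exact hmin W' hW' (lt_of_le_not_ge inf_le_left h)
    exact ((hmem v).1 (hle hv)).2
  choose! χ hχ using key
  obtain ⟨v, hv, hv0⟩ := (Submodule.ne_bot_iff W).1 hW0
  exact ⟨χ, (Submodule.ne_bot_iff _).2 ⟨v, fun w hw => hχ w hw v hv, hv0⟩⟩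

section Character

variable {L : Submodule (ZMod p) (Phase F n)} {χ : Phase F n → ℂ}
  (h0 : jointEigenspace p L χ ≠ ⊥)

include h0

theorem character_zero : χ 0 = 1 := by
  obtain ⟨v, hv, hv0⟩ := (Submodule.ne_bot_iff _).1 h0
  have := hv 0 L.zero_mem
  rw [pauliOp_zero_apply] at this
  exact smul_left_injective ℂ hv0 (by simpa using this.symm)

theorem character_conj_mul_self {w : Phase F n} (hw : w ∈ L) :
    (starRingEnd ℂ) (χ w) * χ w = 1 := by
  obtain ⟨v, hv, hv0⟩ := (Submodule.ne_bot_iff _).1 h0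
  have := inner_pauliOp_pauliOp p w v v
  rw [hv w hw, inner_smul_left, inner_smul_right, ← mul_assoc] at this
  exact mul_right_cancel₀ (inner_self_ne_zero.2 hv0) (this.trans (one_mul _).symm)

theorem character_mul {w w' : Phase F n} (hw : w ∈ L) (hw' : w' ∈ L) :
    χ w * χ w' = ZMod.stdAddChar (traceDot p w.2 w'.1) * χ (w + w') := by
  obtain ⟨v, hv, hv0⟩ := (Submodule.ne_bot_iff _).1 h0
  have := pauliOp_pauliOp p w w' v
  rw [hv w' hw', map_smul, hv w hw, hv _ (L.add_mem hw hw'), smul_smul, smul_smul,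
    mul_comm] at this
  exact smul_left_injective ℂ hv0 this

/-- The eigenvalues are multiplicative only up to a phase; this form is what re-indexing the sum
over L by a translation requires. -/
theorem character_mul_conj_add {w w' : Phase F n} (hw : w ∈ L) (hw' : w' ∈ L) :
    χ w * (starRingEnd ℂ) (χ (w + w')) =
      ZMod.stdAddChar (traceDot p w.2 w'.1) * (starRingEnd ℂ) (χ w') := by
  have h1 := congrArg (starRingEnd ℂ) (character_mul h0 hw hw')
  rw [map_mul, map_mul] at h1
  have h2 := conj_stdAddChar_mul_self p (traceDot p w.2 w'.1)
  have h3 := character_conj_mul_self h0 hw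
  linear_combination (-(ZMod.stdAddChar (traceDot p w.2 w'.1) : ℂ) * χ w) * h1
    + ZMod.stdAddChar (traceDot p w.2 w'.1) * (starRingEnd ℂ) (χ w') * h3
    - χ w * (starRingEnd ℂ) (χ (w + w')) * h2

/-- A nonzero joint eigenspace of an additive code `L` has dimension `q^n / |L|`. -/
theorem finrank_jointEigenspace_mul_card :
    Module.finrank ℂ (jointEigenspace p L χ) * Nat.card L = Fintype.card F ^ n := by
  classical
  -- P/|L| is the projector onto the eigenspace, so its trace is the dimension; only w = 0
  -- contributes to the trace of P.
  let P : Qudits F n →ₗ[ℂ] Qudits F n := ∑ w : L, (starRingEnd ℂ) (χ w) • pauliOp p (w : Phase F n)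
  have hPa : ∀ v, P v = ∑ w : L, (starRingEnd ℂ) (χ w) • pauliOp p (w : Phase F n) v := fun v => by
    simp [P, LinearMap.sum_apply]
  have hc : (Nat.card L : ℂ) ≠ 0 := Nat.cast_ne_zero.2 Nat.card_pos.ne'
  have hPmem : ∀ v, P v ∈ jointEigenspace p L χ := by
    intro v l hl
    rw [hPa, map_sum, Finset.smul_sum,
      ← Equiv.sum_comp (Equiv.addLeft (⟨l, hl⟩ : L)) (fun w : L =>
        χ l • (starRingEnd ℂ) (χ w) • pauliOp p (w : Phase F n) v)]
    refine Finset.sum_congr rfl fun w _ => ?_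
    rw [map_smul, pauliOp_pauliOp, smul_smul, smul_smul, mul_comm,
      ← character_mul_conj_add h0 hl w.2]
    rfl
  have hPfix : ∀ v ∈ jointEigenspace p L χ, P v = (Nat.card L : ℂ) • v := by
    intro v hv
    rw [hPa, Finset.sum_congr rfl (fun (w : L) _ => show _ = v by
      rw [hv w w.2, smul_smul, character_conj_mul_self h0 w.2, one_smul])]
    simp [Nat.card_eq_fintype_card, Nat.cast_smul_eq_nsmul]
  have hproj : LinearMap.IsProj (jointEigenspace p L χ) ((Nat.card L : ℂ)⁻¹ • P) :=
    ⟨fun v => Submodule.smul_mem _ _ (hPmem v), fun v hv => by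
      rw [LinearMap.smul_apply, hPfix v hv, smul_smul, inv_mul_cancel₀ hc, one_smul]⟩
  have htr : LinearMap.trace ℂ _ P = (Fintype.card F : ℂ) ^ n := by
    rw [map_sum, Finset.sum_eq_single (0 : L)]
    · simp [pauliOp_zero, character_zero h0]
    · intro w _ hw
      rw [map_smul, trace_pauliOp_eq_zero p (fun h => hw (Subtype.ext h)), smul_zero]
    · simp
  have := hproj.trace
  rw [map_smul, htr, smul_eq_mul, inv_mul_eq_iff_eq_mul₀ hc] at this
  rw [mul_comm]
  exact_mod_cast this.symm

end Character

end Eigenspace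

/-! ### Orthogonal translates of an eigenspace -/

section CliffordCode

variable {p : ℕ} [Fact p.Prime] {F : Type*} [Field F] [Fintype F] [Algebra (ZMod p) F] {n : ℕ}

/-- Eigenvectors of a unitary for distinct eigenvalues are orthogonal; since eigenvalues have
modulus 1, distinctness reads conj α * β ≠ 1. -/
theorem inner_eq_zero_of_pauliOp_eq_smul {w : Phase F n} {u v : Qudits F n} {α β : ℂ}
    (hu : pauliOp p w u = α • u) (hv : pauliOp p w v = β • v)
    (h : (starRingEnd ℂ) α * β ≠ 1) : ⟪u, v⟫_ℂ = 0 := by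
  have := inner_pauliOp_pauliOp p w u v
  rw [hu, hv, inner_smul_left, inner_smul_right, ← mul_assoc] at this
  by_contra h0
  exact h (mul_right_cancel₀ h0 (this.trans (one_mul _).symm))

theorem pauliOp_pauliOp_of_mem_jointEigenspace {L : Submodule (ZMod p) (Phase F n)}
    {χ : Phase F n → ℂ} {u : Qudits F n} (hu : u ∈ jointEigenspace p L χ) {l : Phase F n}
    (hl : l ∈ L) (w : Phase F n) :
    pauliOp p l (pauliOp p w u) =
      ((ZMod.stdAddChar (sympl p l w) : ℂ) * χ l) • pauliOp p w u := by
  rw [pauliOp_comm, hu l hl, map_smul, smul_smul]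

/-- Orthogonality of characters: shifting the sum by an l with nontrivial value multiplies it by a
number other than 1. -/
theorem sum_stdAddChar_sympl {L : Submodule (ZMod p) (Phase F n)} [Fintype L] {w : Phase F n}
    (h : ∃ l ∈ L, sympl p l w ≠ 0) :
    ∑ l : L, (ZMod.stdAddChar (sympl p l w) : ℂ) = 0 := by
  obtain ⟨l₀, hl₀, h⟩ := h
  have h1 : (ZMod.stdAddChar (sympl p l₀ w) : ℂ) * ∑ l : L, (ZMod.stdAddChar (sympl p l w) : ℂ) =
      ∑ l : L, (ZMod.stdAddChar (sympl p l w) : ℂ) := by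
    rw [Finset.mul_sum, ← Equiv.sum_comp (Equiv.addLeft (⟨l₀, hl₀⟩ : L)) (fun l : L =>
      (ZMod.stdAddChar (sympl p l w) : ℂ))]
    refine Finset.sum_congr rfl fun l _ => ?_
    rw [← AddChar.map_add_eq_mul, ← LinearMap.add_apply, ← map_add]
    rfl
  by_contra h0
  exact h ((stdAddChar_eq_one_iff p).1 (mul_right_cancel₀ h0 (h1.trans (one_mul _).symm)))

/-- The linear map `a ⊗ |j⟩ ↦ E_(t j) (ι a)`. -/
def translateMap {K R : ℕ} (ι : EuclideanSpace ℂ (Fin K) →ₗ[ℂ] Qudits F n)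
    (t : Fin R → Phase F n) : Bipartite K R →ₗ[ℂ] Qudits F n :=
  TensorProduct.lift (LinearMap.flip ((EuclideanSpace.basisFun (Fin R) ℂ).toBasis.constr ℂ
    fun j => pauliOp p (t j) ∘ₗ ι))

theorem translateMap_tmul_single {K R : ℕ} (ι : EuclideanSpace ℂ (Fin K) →ₗ[ℂ] Qudits F n)
    (t : Fin R → Phase F n) (a : EuclideanSpace ℂ (Fin K)) (j : Fin R) :
    translateMap (p := p) ι t (a ⊗ₜ EuclideanSpace.single j 1) = pauliOp p (t j) (ι a) := by
  have h := (EuclideanSpace.basisFun (Fin R) ℂ).toBasis.constr_basis ℂ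
    (fun j => pauliOp p (t j) ∘ₗ ι) j
  rw [OrthonormalBasis.coe_toBasis, EuclideanSpace.basisFun_apply] at h
  rw [translateMap, TensorProduct.lift.tmul, LinearMap.flip_apply, h, LinearMap.comp_apply]

theorem linearMap_ext_single {R : ℕ} {M : Type*} [AddCommGroup M] [Module ℂ M]
    {f g : EuclideanSpace ℂ (Fin R) →ₗ[ℂ] M}
    (h : ∀ j, f (EuclideanSpace.single j 1) = g (EuclideanSpace.single j 1)) : f = g :=
  (EuclideanSpace.basisFun (Fin R) ℂ).toBasis.ext fun j => by
    rw [OrthonormalBasis.coe_toBasis, EuclideanSpace.basisFun_apply, h]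

theorem inner_single_single {R : ℕ} (i j : Fin R) :
    ⟪(EuclideanSpace.single i 1 : EuclideanSpace ℂ (Fin R)), EuclideanSpace.single j 1⟫_ℂ =
      if i = j then 1 else 0 := by
  have := orthonormal_iff_ite.1 (EuclideanSpace.basisFun (Fin R) ℂ).orthonormal i j
  rwa [EuclideanSpace.basisFun_apply, EuclideanSpace.basisFun_apply] at this

/-- The isometric embedding `a ⊗ |j⟩ ↦ E_(t j) (ι a)`, for a transversal `t` whose points are
separated by `L`, so that the translates of the eigenspace are orthogonal. -/
def translateIsometry {K R : ℕ} {L : Submodule (ZMod p) (Phase F n)} {χ : Phase F n → ℂ}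
    (h0 : jointEigenspace p L χ ≠ ⊥)
    (ι : EuclideanSpace ℂ (Fin K) →ₗᵢ[ℂ] Qudits F n)
    (hι : ∀ a, ι a ∈ jointEigenspace p L χ) (t : Fin R → Phase F n)
    (ht : ∀ i j, (∀ l ∈ L, sympl p l (t i - t j) = 0) → i = j) :
    Bipartite K R →ₗᵢ[ℂ] Qudits F n :=
  (translateMap (p := p) ι.toLinearMap t).isometryOfOrthonormal
    (v := ((EuclideanSpace.basisFun (Fin K) ℂ).tensorProduct
      (EuclideanSpace.basisFun (Fin R) ℂ)).toBasis)
    (by rw [OrthonormalBasis.coe_toBasis]; exact OrthonormalBasis.orthonormal _) (by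
      rw [orthonormal_iff_ite]
      rintro ⟨i, j⟩ ⟨i', j'⟩
      simp only [Function.comp_apply, OrthonormalBasis.coe_toBasis,
        OrthonormalBasis.tensorProduct_apply, EuclideanSpace.basisFun_apply,
        translateMap_tmul_single, LinearIsometry.coe_toLinearMap, Prod.mk.injEq]
      by_cases hj : j = j'
      · subst hj
        rw [inner_pauliOp_pauliOp, LinearIsometry.inner_map_map, inner_single_single]
        simp
      · have : ∃ l ∈ L, sympl p l (t j' - t j) ≠ 0 := by
          by_contra! h
          exact hj (ht j' j h).symm
        obtain ⟨l, hl, h⟩ := this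
        rw [if_neg (fun h => hj h.2)]
        refine inner_eq_zero_of_pauliOp_eq_smul
          (pauliOp_pauliOp_of_mem_jointEigenspace (hι _) hl _)
          (pauliOp_pauliOp_of_mem_jointEigenspace (hι _) hl _) fun h1 => h ?_
        rw [← stdAddChar_eq_one_iff p, map_sub, sub_eq_add_neg, AddChar.map_add_eq_mul,
          AddChar.map_neg_eq_inv]
        have h2 := conj_stdAddChar_mul_self p (sympl p l (t j))
        have h3 := character_conj_mul_self h0 hl
        have h4 := stdAddChar_ne_zero p (sympl p l (t j))
        rw [map_mul] at h1
        field_simp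
        linear_combination (ZMod.stdAddChar (sympl p l (t j)) : ℂ) * h1
          - (ZMod.stdAddChar (sympl p l (t j)) : ℂ) * ZMod.stdAddChar (sympl p l (t j')) *
            (starRingEnd ℂ) (ZMod.stdAddChar (sympl p l (t j))) * h3
          - (ZMod.stdAddChar (sympl p l (t j')) : ℂ) * h2)

theorem translateIsometry_tmul_single {K R : ℕ} {L : Submodule (ZMod p) (Phase F n)}
    {χ : Phase F n → ℂ} (h0 : jointEigenspace p L χ ≠ ⊥)
    (ι : EuclideanSpace ℂ (Fin K) →ₗᵢ[ℂ] Qudits F n)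
    (hι : ∀ a, ι a ∈ jointEigenspace p L χ) (t : Fin R → Phase F n)
    (ht : ∀ i j, (∀ l ∈ L, sympl p l (t i - t j) = 0) → i = j)
    (a : EuclideanSpace ℂ (Fin K)) (j : Fin R) :
    translateIsometry h0 ι hι t ht (a ⊗ₜ EuclideanSpace.single j 1) = pauliOp p (t j) (ι a) :=
  translateMap_tmul_single _ _ _ _

/-- An isometric parametrization of a joint eigenspace. -/
theorem exists_isometry_jointEigenspace {K : ℕ} {L : Submodule (ZMod p) (Phase F n)}
    {χ : Phase F n → ℂ} (hK : Module.finrank ℂ (jointEigenspace p L χ) = K) :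
    ∃ ι : EuclideanSpace ℂ (Fin K) →ₗᵢ[ℂ] Qudits F n,
      ∀ v, v ∈ jointEigenspace p L χ ↔ ∃ a, ι a = v := by
  subst hK
  refine ⟨(jointEigenspace p L χ).subtypeₗᵢ.comp
    (stdOrthonormalBasis ℂ (jointEigenspace p L χ)).repr.symm.toLinearIsometry, fun v => ⟨fun hv =>
      ⟨(stdOrthonormalBasis ℂ (jointEigenspace p L χ)).repr ⟨v, hv⟩, by simp⟩, ?_⟩⟩
  rintro ⟨a, rfl⟩
  simp

end CliffordCode

/-! ### Clifford subsystem codes and stabilizer codes from isotropic subspaces -/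

section CliffordCode

variable {p : ℕ} [Fact p.Prime] {F : Type*} [Field F] [Fintype F] [Algebra (ZMod p) F] {n : ℕ}

/-- The phase in `E_(τ + l) E_t u = phase • E_(τ + t) u`, for an eigenvector `u` of `E_l`. -/
def translatePhase (p : ℕ) [Fact p.Prime] [Algebra (ZMod p) F] (χ : Phase F n → ℂ)
    (t τ l : Phase F n) : ℂ :=
  ZMod.stdAddChar (traceDot p (τ + l).2 t.1 - traceDot p (τ + t).2 l.1) * χ l

theorem pauliOp_translate {L : Submodule (ZMod p) (Phase F n)} {χ : Phase F n → ℂ}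
    {u : Qudits F n} (hu : u ∈ jointEigenspace p L χ) {l : Phase F n} (hl : l ∈ L)
    (t τ : Phase F n) :
    pauliOp p (τ + l) (pauliOp p t u) = translatePhase p χ t τ l • pauliOp p (τ + t) u := by
  have h := pauliOp_pauliOp p (τ + t) l u
  rw [hu l hl, map_smul] at h
  rw [translatePhase, mul_smul, h, smul_smul, ← AddChar.map_add_eq_mul, sub_add_cancel,
    pauliOp_pauliOp, add_right_comm]

theorem translatePhase_ne_zero {L : Submodule (ZMod p) (Phase F n)} {χ : Phase F n → ℂ}
    (h0 : jointEigenspace p L χ ≠ ⊥) {l : Phase F n} (hl : l ∈ L) (t τ : Phase F n) :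
    translatePhase p χ t τ l ≠ 0 :=
  mul_ne_zero (stdAddChar_ne_zero p _) (right_ne_zero_of_mul_eq_one (character_conj_mul_self h0 hl))

theorem translatePhase_zero (χ : Phase F n → ℂ) (t l : Phase F n) :
    translatePhase p χ t 0 l = ZMod.stdAddChar (sympl p l t) * χ l := by
  rw [translatePhase, zero_add, zero_add, sympl_apply, traceDot_comm p t.2]

/-- The action of `T ⊔ L` on the co-subsystem spanned by the elements of the transversal `T`. -/
theorem exists_translateAction {R : ℕ} {T L : Submodule (ZMod p) (Phase F n)} (hTL : Disjoint T L)
    (e : Fin R ≃ T) (χ : Phase F n → ℂ) :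
    ∃ σ : Phase F n → (EuclideanSpace ℂ (Fin R) →ₗ[ℂ] EuclideanSpace ℂ (Fin R)),
      ∀ (τ : T), ∀ l ∈ L, ∀ j, σ (τ + l) (EuclideanSpace.single j 1) =
        translatePhase p χ (e j) τ l • EuclideanSpace.single (e.symm (τ + e j)) 1 := by
  -- Outside T ⊔ L the components are arbitrary, since σ matters only on that subspace; inside it,
  -- disjointness makes them unique.
  have hdec : ∀ w : Phase F n, ∃ (τ : T) (l : L), w ∈ T ⊔ L → (τ : Phase F n) + l = w := by
    intro w
    by_cases hw : w ∈ T ⊔ L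
    · obtain ⟨τ, hτ, l, hl, h⟩ := Submodule.mem_sup.1 hw
      exact ⟨⟨τ, hτ⟩, ⟨l, hl⟩, fun _ => h⟩
    · exact ⟨0, 0, fun h => absurd h hw⟩
  choose τ l hτl using hdec
  refine ⟨fun w => (EuclideanSpace.basisFun (Fin R) ℂ).toBasis.constr ℂ fun j =>
    translatePhase p χ (e j) (τ w) (l w) • EuclideanSpace.single (e.symm (τ w + e j)) 1,
    fun τ' l' hl' j => ?_⟩
  have hmem : (τ' : Phase F n) + l' ∈ T ⊔ L := Submodule.add_mem_sup τ'.2 hl'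
  have hsum := hτl _ hmem
  have hdiff : ((τ (τ' + l') - τ' : T) : Phase F n) = l' - l (τ' + l') := by
    rw [Submodule.coe_sub, sub_eq_sub_iff_add_eq_add, hsum, add_comm]
  have hzero := Submodule.disjoint_def.1 hTL _ (τ (τ' + l') - τ').2
    (by rw [hdiff]; exact L.sub_mem hl' (l _).2)
  have h1 : τ (τ' + l') = τ' := sub_eq_zero.1 (Subtype.ext hzero)
  have h2 : (l (τ' + l') : Phase F n) = l' := by
    rw [hdiff, sub_eq_zero] at hzero; exact hzero.symm
  have h := (EuclideanSpace.basisFun (Fin R) ℂ).toBasis.constr_basis ℂ (fun j =>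
    translatePhase p χ (e j) (τ (τ' + l')) (l (τ' + l')) •
      (EuclideanSpace.single (e.symm (τ (τ' + l') + e j)) 1 : EuclideanSpace ℂ (Fin R))) j
  rw [OrthonormalBasis.coe_toBasis, EuclideanSpace.basisFun_apply] at h
  rw [h, h1, h2]

theorem eq_top_of_forall_single_mem {R : ℕ} {W : Submodule ℂ (EuclideanSpace ℂ (Fin R))}
    (h : ∀ j, EuclideanSpace.single j 1 ∈ W) : W = ⊤ := by
  rw [eq_top_iff, ← (EuclideanSpace.basisFun (Fin R) ℂ).toBasis.span_eq, Submodule.span_le]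
  rintro _ ⟨j, rfl⟩
  rw [OrthonormalBasis.coe_toBasis, EuclideanSpace.basisFun_apply]
  exact h j

theorem eq_sum_single {R : ℕ} (b : EuclideanSpace ℂ (Fin R)) :
    b = ∑ j, b j • EuclideanSpace.single j (1 : ℂ) := by
  ext i
  simp [Pi.single_apply]

/-- The translates of a joint eigenspace of an isotropic `L` by a transversal `T` on which `L`
separates points form a Clifford subsystem code. -/
theorem exists_clifford_code {T L Z : Submodule (ZMod p) (Phase F n)} (hL : Isotropic L)
    (hT : ∀ t ∈ T, (∀ l ∈ L, sympl p l t = 0) → t = 0) (hZL : Z ≤ L)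
    (hZT : ∀ z ∈ Z, ∀ t ∈ T, sympl p z t = 0) (hne : T ⊔ L ≠ ⊥)
    {K R d : ℕ} (hK : 0 < K) (hLK : K * Nat.card L = Fintype.card F ^ n) (hR : Nat.card T = R)
    (hd : ∀ w : Phase F n, swt w < d → (∀ z ∈ Z, sympl p z w = 0) → w ∈ T ⊔ L) :
    ∃ Q : Code F n K R, Q.IsClifford p ∧ Q.MinDistGE p d := by
  classical
  obtain ⟨χ, h0⟩ := hL.exists_jointEigenspace_ne_bot
  have hfin : Module.finrank ℂ (jointEigenspace p L χ) = K :=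
    Nat.eq_of_mul_eq_mul_right (Nat.card_pos (α := L))
      ((finrank_jointEigenspace_mul_card h0).trans hLK.symm)
  obtain ⟨ι, hι⟩ := exists_isometry_jointEigenspace hfin
  have hιm : ∀ a, ι a ∈ jointEigenspace p L χ := fun a => (hι _).2 ⟨a, rfl⟩
  let e : Fin R ≃ T := (Finite.equivFinOfCardEq hR).symm
  have hRpos : 0 < R := hR ▸ Nat.card_pos
  have hTL : Disjoint T L := Submodule.disjoint_def.2 fun t ht htL =>
    hT t ht fun l hl => hL l hl t htL
  obtain ⟨σ, hσ⟩ := exists_translateAction hTL e χ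
  have ht : ∀ i j, (∀ l ∈ L, sympl p l ((e i : Phase F n) - e j) = 0) → i = j := fun i j h =>
    e.injective (Subtype.ext (sub_eq_zero.1 (hT _ (T.sub_mem (e i).2 (e j).2) h)))
  let V := translateIsometry h0 ι hιm (fun j => (e j : Phase F n)) ht
  have hV : ∀ a j, V (a ⊗ₜ EuclideanSpace.single j 1) = pauliOp p (e j) (ι a) :=
    translateIsometry_tmul_single h0 ι hιm _ ht
  have hact : ∀ w ∈ T ⊔ L, ∀ a b, pauliOp p w (V (a ⊗ₜ[ℂ] b)) = V (a ⊗ₜ[ℂ] σ w b) := by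
    intro w hw a b
    obtain ⟨τ, hτ, l, hl, rfl⟩ := Submodule.mem_sup.1 hw
    suffices h : pauliOp p (τ + l) ∘ₗ V.toLinearMap ∘ₗ TensorProduct.mk ℂ _ _ a =
        V.toLinearMap ∘ₗ TensorProduct.mk ℂ _ _ a ∘ₗ σ (τ + l) from LinearMap.congr_fun h b
    refine linearMap_ext_single fun j => ?_
    simp only [LinearMap.comp_apply, TensorProduct.mk_apply, LinearIsometry.coe_toLinearMap]
    have := hσ ⟨τ, hτ⟩ l hl j
    rw [this, TensorProduct.tmul_smul, map_smul, hV, hV, pauliOp_translate (hιm a) hl,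
      Equiv.apply_symm_apply]
    rfl
  have hσL : ∀ l ∈ L, ∀ j, σ l (EuclideanSpace.single j 1) =
      (ZMod.stdAddChar (sympl p l (e j)) * χ l) • EuclideanSpace.single j (1 : ℂ) := by
    intro l hl j
    have := hσ 0 l hl j
    rwa [Submodule.coe_zero, translatePhase_zero, zero_add, zero_add, Equiv.symm_apply_apply] at this
  have hσT : ∀ i j, ∃ c : ℂ, c ≠ 0 ∧ σ ((e j - e i : T) : Phase F n) (EuclideanSpace.single i 1) =
      c • EuclideanSpace.single j (1 : ℂ) := by
    intro i j
    have := hσ (e j - e i) 0 L.zero_mem i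
    rw [add_zero, sub_add_cancel, Equiv.symm_apply_apply] at this
    exact ⟨_, translatePhase_ne_zero h0 L.zero_mem _ _, this⟩
  refine ⟨⟨⟨hK, hRpos⟩, V⟩, ⟨(T ⊔ L).toAddSubgroup, ?_, σ, fun w hw => hact w hw, ?_, ?_⟩, ?_⟩
  · intro h
    refine hne ((Submodule.eq_bot_iff _).2 fun x hx => ?_)
    have : x ∈ (T ⊔ L).toAddSubgroup := hx
    rwa [h, AddSubgroup.mem_bot] at this
  · intro W hW
    refine or_iff_not_imp_left.2 fun hW0 => eq_top_of_forall_single_mem fun j => ?_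
    obtain ⟨b, hb, hb0⟩ := (Submodule.ne_bot_iff W).1 hW0
    obtain ⟨s, hs⟩ : ∃ s, b s ≠ 0 := by
      by_contra! h
      exact hb0 (PiLp.ext h)
    have hσb : ∀ l ∈ L, σ l b = ∑ j, b j • (ZMod.stdAddChar (sympl p l (e j)) * χ l) •
        EuclideanSpace.single j (1 : ℂ) := by
      intro l hl
      conv_lhs => rw [eq_sum_single b]
      rw [map_sum]
      exact Finset.sum_congr rfl fun j _ => by rw [map_smul, hσL l hl]
    -- Averaging over L against the conjugate of the character at s isolates the component of b
    -- along |s⟩. Thus W contains one basis vector, and T carries it to all others.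
    have hsum : ∑ l : L, ((starRingEnd ℂ) (χ l) * ZMod.stdAddChar (-sympl p (l : Phase F n) (e s))) •
        σ l b = (Fintype.card L * b s) • EuclideanSpace.single s (1 : ℂ) := by
      have : ∀ l : L, ((starRingEnd ℂ) (χ l) *
          ZMod.stdAddChar (-sympl p (l : Phase F n) (e s))) • σ l b =
          ∑ j, (ZMod.stdAddChar (sympl p (l : Phase F n) ((e j : Phase F n) - e s)) * b j) •
            EuclideanSpace.single j (1 : ℂ) := by
        intro l
        rw [hσb l l.2, Finset.smul_sum]
        refine Finset.sum_congr rfl fun j _ => ?_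
        rw [smul_smul, smul_smul, map_sub, sub_eq_add_neg, AddChar.map_add_eq_mul]
        congr 1
        linear_combination (ZMod.stdAddChar (-sympl p (l : Phase F n) (e s)) * b j *
          ZMod.stdAddChar (sympl p (l : Phase F n) (e j)) : ℂ) * character_conj_mul_self h0 l.2
      rw [Finset.sum_congr rfl fun l _ => this l, Finset.sum_comm, Finset.sum_eq_single s]
      · simp [mul_smul, Nat.cast_smul_eq_nsmul]
      · intro j _ hj
        rw [← Finset.sum_smul, ← Finset.sum_mul, sum_stdAddChar_sympl, zero_mul, zero_smul]
        by_contra! h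
        exact hj (ht j s h)
      · simp
    have hsW : EuclideanSpace.single s (1 : ℂ) ∈ W := by
      have h1 : (Fintype.card L * b s) • EuclideanSpace.single s (1 : ℂ) ∈ W := by
        rw [← hsum]
        exact W.sum_mem fun l _ => W.smul_mem _
          (hW l (Submodule.mem_sup_right l.2 : (l : Phase F n) ∈ T ⊔ L) b hb)
      exact (W.smul_mem_iff (mul_ne_zero (Nat.cast_ne_zero.2 Fintype.card_ne_zero) hs)).1 h1
    obtain ⟨c, hc, hcs⟩ := hσT s j
    refine (W.smul_mem_iff hc).1 ?_
    rw [← hcs]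
    exact hW _ (Submodule.mem_sup_left (e j - e s).2 : _ ∈ T ⊔ L) _ hsW
  · rintro U hU _ ⟨b, rfl⟩
    -- The basis vector labelled 0 in T has L-character χ, so an intertwiner sends it into the
    -- eigenspace, to some ι a. Applying T then forces U |j⟩ to be a multiple of V (a ⊗ |j⟩).
    have hT0 : U (EuclideanSpace.single (e.symm 0) 1) ∈ jointEigenspace p L χ := by
      intro l hl
      rw [hU l (Submodule.mem_sup_right hl : l ∈ T ⊔ L), hσL l hl, map_smul]
      simp
    obtain ⟨a, ha⟩ := (hι _).1 hT0
    rw [eq_sum_single b, map_sum]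
    refine Submodule.sum_mem _ fun j _ => ?_
    rw [map_smul]
    refine Submodule.smul_mem _ _ ?_
    obtain ⟨c, hc, hcs⟩ := hσT (e.symm 0) j
    refine (Submodule.smul_mem_iff _ hc).1 ⟨a ⊗ₜ EuclideanSpace.single j 1, ?_⟩
    rw [← map_smul, ← hcs, ← hU _ (Submodule.mem_sup_left (Subtype.prop _) : _ ∈ T ⊔ L), ← ha]
    refine (hV a j).trans ?_
    rw [Equiv.apply_symm_apply, sub_zero]
  · intro c w hw
    by_cases hZ : ∀ z ∈ Z, sympl p z w = 0
    · have hwX := hd w hw hZ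
      refine ⟨(ZMod.stdAddChar c : ℂ) • σ w, fun x y => ?_⟩
      have h1 : errorOp p c w ∘ₗ V.toLinearMap =
          V.toLinearMap ∘ₗ TensorProduct.map LinearMap.id ((ZMod.stdAddChar c : ℂ) • σ w) := by
        refine TensorProduct.ext' fun a b => ?_
        simp only [LinearMap.comp_apply, LinearIsometry.coe_toLinearMap, TensorProduct.map_tmul,
          LinearMap.id_apply, LinearMap.smul_apply, TensorProduct.tmul_smul, map_smul, errorOp]
        rw [hact w hwX]
      have h2 := LinearMap.congr_fun h1 y
      change ⟪V x, errorOp p c w (V y)⟫_ℂ = _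
      rw [← V.inner_map_map x]
      exact congrArg _ h2
    · push Not at hZ
      obtain ⟨z, hz, hzw⟩ := hZ
      -- Since Z is orthogonal to T, translating by T does not change the eigenvalue of z. The error
      -- w does change it, so it maps the code into its orthogonal complement and M = 0 works.
      have hzV : ∀ x, pauliOp p z (V x) = χ z • V x := by
        intro x
        induction x using TensorProduct.induction_on with
        | zero => simp
        | add x y hx hy => rw [map_add, map_add, hx, hy, smul_add]
        | tmul a b =>
          have : pauliOp p z ∘ₗ V.toLinearMap ∘ₗ TensorProduct.mk ℂ _ _ a =
              χ z • (V.toLinearMap ∘ₗ TensorProduct.mk ℂ _ _ a) := by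
            refine linearMap_ext_single fun j => ?_
            simp only [LinearMap.comp_apply, TensorProduct.mk_apply, LinearMap.smul_apply,
              LinearIsometry.coe_toLinearMap]
            rw [hV, pauliOp_pauliOp_of_mem_jointEigenspace (hιm a) (hZL hz), hZT z hz _ (e j).2,
              AddChar.map_zero_eq_one, one_mul]
          exact LinearMap.congr_fun this b
      refine ⟨0, fun x y => ?_⟩
      change ⟪V x, errorOp p c w (V y)⟫_ℂ = _
      rw [TensorProduct.map_zero_right, LinearMap.zero_apply, inner_zero_right, errorOp,
        LinearMap.smul_apply, inner_smul_right]
      rw [inner_eq_zero_of_pauliOp_eq_smul (hzV x) (β := ZMod.stdAddChar (sympl p z w) * χ z)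
        (by rw [pauliOp_comm, hzV, map_smul, smul_smul]), mul_zero]
      rw [mul_left_comm, character_conj_mul_self h0 (hZL hz), mul_one]
      exact fun h => hzw ((stdAddChar_eq_one_iff p).1 h)

/-- A joint eigenspace of an isotropic `L` is a stabilizer code; its minimum distance is at
least `d` if all vectors of weight less than `d` in the symplectic dual of `L` belong to `L`. -/
theorem exists_stabilizer_code {L : Submodule (ZMod p) (Phase F n)} (hL : Isotropic L)
    {K d : ℕ} (hLK : K * Nat.card L = Fintype.card F ^ n)
    (hd : ∀ w : Phase F n, swt w < d → (∀ z ∈ L, sympl p z w = 0) → w ∈ L) :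
    ∃ Q : Submodule ℂ (Qudits F n),
      IsStabilizerCode p Q ∧ Module.finrank ℂ Q = K ∧ StabilizerMinDistGE p Q d := by
  obtain ⟨χ, h0⟩ := hL.exists_jointEigenspace_ne_bot
  refine ⟨jointEigenspace p L χ, ⟨h0, L.toAddSubgroup, χ, fun w hw w' hw' =>
    pauliOp_commute p (hL w hw w' hw'), fun v => Iff.rfl⟩,
    Nat.eq_of_mul_eq_mul_right (Nat.card_pos (α := L))
      ((finrank_jointEigenspace_mul_card h0).trans hLK.symm), fun c w hw => ?_⟩
  by_cases hZ : ∀ z ∈ L, sympl p z w = 0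
  · refine ⟨ZMod.stdAddChar c * χ w, fun u _ v hv => ?_⟩
    rw [errorOp, LinearMap.smul_apply, hv w (hd w hw hZ), smul_smul, inner_smul_right]
  · push Not at hZ
    obtain ⟨z, hz, hzw⟩ := hZ
    refine ⟨0, fun u hu v hv => ?_⟩
    rw [errorOp, LinearMap.smul_apply, inner_smul_right, inner_eq_zero_of_pauliOp_eq_smul (hu z hz)
      (pauliOp_pauliOp_of_mem_jointEigenspace hv hz w), mul_zero, zero_mul]
    rw [mul_left_comm, character_conj_mul_self h0 hz, mul_one]
    exact fun h => hzw ((stdAddChar_eq_one_iff p).1 h)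

end CliffordCode

/-! ### Averaging over a transitive group action -/

section Averaging

/-- If a finite group acts transitively on `Ω`, then some element moves `Y` off `D`, provided that
`|Y| |D| < m |Ω|`, where `m` is the least size of a nonempty intersection of `D` with a translate
of `Y`. -/
theorem exists_forall_smul_notMem {G Ω : Type*} [Group G] [Fintype G] [Fintype Ω]
    [DecidableEq Ω] [MulAction G Ω] [MulAction.IsPretransitive G Ω] (Y D : Finset Ω) (m : ℕ)
    (hm : ∀ g : G, (∃ y ∈ Y, g • y ∈ D) → m ≤ (Y.filter fun y => g • y ∈ D).card)
    (hlt : Y.card * D.card < m * Fintype.card Ω) :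
    ∃ g : G, ∀ y ∈ Y, g • y ∉ D := by
  by_contra! hno
  have hN : ∀ y x x' : Ω, (Finset.univ.filter fun g : G => g • y = x).card =
      (Finset.univ.filter fun g : G => g • y = x').card := by
    intro y x x'
    obtain ⟨h, rfl⟩ := MulAction.exists_smul_eq G x x'
    refine Finset.card_bij (fun g _ => h * g) (fun g hg => ?_) (fun a _ b _ h => ?_) fun g hg => ?_
    · simp only [Finset.mem_filter, Finset.mem_univ, true_and] at hg ⊢
      rw [mul_smul, hg]
    · exact mul_left_cancel h
    · simp only [Finset.mem_filter, Finset.mem_univ, true_and] at hg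
      exact ⟨h⁻¹ * g, by simp [mul_smul, hg], by simp⟩
  -- A given y is sent to each x by exactly |G|/|Ω| elements, so the collisions total |Y| |D| |G| /
  -- |Ω|. If every g had one, the total would be at least m |G|.
  have hNcard : ∀ y x : Ω, Fintype.card Ω * (Finset.univ.filter fun g : G => g • y = x).card =
      Fintype.card G := by
    intro y x
    rw [← Finset.card_univ (α := G), Finset.card_eq_sum_card_fiberwise (s := Finset.univ (α := G))
      (f := fun g : G => g • y) (t := Finset.univ) (fun _ _ => Finset.mem_coe.2 (Finset.mem_univ _)),
      Finset.sum_congr rfl fun x' _ => hN y x' x, Finset.sum_const, smul_eq_mul, Finset.card_univ]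
  have hsum : ∑ g : G, (Y.filter fun y => g • y ∈ D).card =
      ∑ y ∈ Y, ∑ x ∈ D, (Finset.univ.filter fun g : G => g • y = x).card := by
    simp only [Finset.card_filter]
    rw [Finset.sum_comm]
    refine Finset.sum_congr rfl fun y _ => ?_
    rw [Finset.sum_comm]
    refine Finset.sum_congr rfl fun g _ => ?_
    rw [Finset.sum_ite_eq]
  have h1 : Fintype.card G * m ≤ ∑ g : G, (Y.filter fun y => g • y ∈ D).card := by
    rw [← smul_eq_mul, ← Finset.card_univ, ← Finset.sum_const]
    exact Finset.sum_le_sum fun g _ => hm g (hno g)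
  have h2 : Fintype.card Ω * ∑ g : G, (Y.filter fun y => g • y ∈ D).card =
      Y.card * D.card * Fintype.card G := by
    rw [hsum, Finset.mul_sum, Finset.sum_congr rfl fun y _ => by
      rw [Finset.mul_sum, Finset.sum_congr rfl fun x _ => hNcard y x]]
    simp only [Finset.sum_const, smul_eq_mul]
    ring
  have h3 := Nat.mul_le_mul_left (Fintype.card Ω) h1
  rw [h2] at h3
  have h4 := Nat.mul_lt_mul_of_pos_right hlt (Fintype.card_pos (α := G))
  nlinarith

end Averaging

/-! ### Transitivity of the symplectic group -/

section Symplectic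

variable (p : ℕ) [Fact p.Prime] {F : Type*} [Field F] [Fintype F] [Algebra (ZMod p) F] {n : ℕ}

/-- The group of linear automorphisms that preserve the trace-symplectic form. -/
def symplGroup (F : Type*) [Field F] [Fintype F] [Algebra (ZMod p) F] (n : ℕ) :
    Subgroup (Phase F n ≃ₗ[ZMod p] Phase F n) where
  carrier := {g | ∀ u v, sympl p (g u) (g v) = sympl p u v}
  mul_mem' {g h} hg hh u v := by rw [LinearEquiv.mul_apply, LinearEquiv.mul_apply, hg, hh]
  one_mem' _ _ := rfl
  inv_mem' {g} hg u v := by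
    have h : ∀ x, g (g⁻¹ x) = x := fun x => g.apply_symm_apply x
    rw [← hg, h, h]

variable {p}

/-- The transvection along w' - w does it: as ⟨w, w' - w⟩ = ⟨w, w'⟩ ≠ 0, the scalar c can be chosen
so that w moves by exactly w' - w. -/
theorem exists_symplGroup_apply_eq_of_sympl_ne_zero {w w' : Phase F n} (h : sympl p w w' ≠ 0) :
    ∃ g ∈ symplGroup p F n, g w = w' := by
  set c := (sympl p w w')⁻¹
  have hu : (-c • sympl p (w' - w)) (w' - w) = 0 := by
    rw [LinearMap.smul_apply, sympl_self, smul_zero]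
  have ha : ∀ x, LinearEquiv.transvection hu x = x + (c * sympl p x (w' - w)) • (w' - w) := by
    intro x
    change x + ((-c • sympl p (w' - w)) x) • (w' - w) = _
    rw [LinearMap.smul_apply, sympl_swap p (w' - w) x, smul_eq_mul, neg_mul_neg]
  refine ⟨LinearEquiv.transvection hu, fun x y => ?_, ?_⟩
  · rw [ha, ha]
    simp only [map_add, map_smul, LinearMap.add_apply, LinearMap.smul_apply, smul_eq_mul,
      sympl_self]
    rw [sympl_swap p (w' - w) y]
    ring
  · rw [ha, map_sub, sympl_self, sub_zero, inv_mul_cancel₀ h, one_smul, add_sub_cancel]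

/-- Two transvections suffice, passing through a vector v orthogonal to neither w nor w'. -/
theorem exists_symplGroup_apply_eq {w w' : Phase F n} (hw : w ≠ 0) (hw' : w' ≠ 0) :
    ∃ g ∈ symplGroup p F n, g w = w' := by
  obtain ⟨v, hv, hv'⟩ : ∃ v, sympl p w v ≠ 0 ∧ sympl p w' v ≠ 0 := by
    obtain ⟨v₁, h₁⟩ := exists_sympl_ne_zero p hw
    obtain ⟨v₂, h₂⟩ := exists_sympl_ne_zero p hw'
    by_cases h₃ : sympl p w' v₁ = 0
    · by_cases h₄ : sympl p w v₂ = 0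
      · exact ⟨v₁ + v₂, by rwa [map_add, h₄, add_zero], by rwa [map_add, h₃, zero_add]⟩
      · exact ⟨v₂, h₄, h₂⟩
    · exact ⟨v₁, h₁, h₃⟩
  obtain ⟨g, hg, rfl⟩ := exists_symplGroup_apply_eq_of_sympl_ne_zero hv
  obtain ⟨h, hh, rfl⟩ := exists_symplGroup_apply_eq_of_sympl_ne_zero
    (mt (sympl_eq_zero_comm p).2 hv')
  exact ⟨h * g, mul_mem hh hg, rfl⟩

/-- The symplectic group acts transitively on nonzero vectors, so that a set `Y` of nonzero vectors
that is not too large can be moved off `D`. -/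
theorem exists_symplGroup_forall_notMem (Y D : Finset (Phase F n)) (hY0 : 0 ∉ Y) (hD0 : 0 ∉ D)
    (hY : ∀ c : ZMod p, c ≠ 0 → ∀ y ∈ Y, c • y ∈ Y) (hD : ∀ c : ZMod p, c ≠ 0 → ∀ y ∈ D, c • y ∈ D)
    (hlt : Y.card * D.card < (p - 1) * (Fintype.card (Phase F n) - 1)) :
    ∃ g ∈ symplGroup p F n, ∀ y ∈ Y, g y ∉ D := by
  classical
  have : Finite (Phase F n ≃ₗ[ZMod p] Phase F n) := DFunLike.finite _
  have : Fintype (symplGroup p F n) := Fintype.ofFinite _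
  let Ω := {w : Phase F n // w ≠ 0}
  let act : MulAction (symplGroup p F n) Ω :=
    { smul := fun g w => ⟨g.1 w.1, (LinearEquiv.map_ne_zero_iff _).2 w.2⟩
      one_smul := fun _ => rfl
      mul_smul := fun _ _ _ => rfl }
  have hact : ∀ (g : symplGroup p F n) (w : Ω), ((g • w : Ω) : Phase F n) = g.1 w.1 :=
    fun _ _ => rfl
  have : MulAction.IsPretransitive (symplGroup p F n) Ω := ⟨fun w w' => by
    obtain ⟨g, hg, h⟩ := exists_symplGroup_apply_eq (p := p) w.2 w'.2
    exact ⟨⟨g, hg⟩, Subtype.ext h⟩⟩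
  have hsub : ∀ S : Finset (Phase F n), 0 ∉ S → (S.subtype (· ≠ 0)).card = S.card := by
    intro S hS
    rw [Finset.card_subtype, Finset.filter_true_of_mem]
    rintro x hx rfl
    exact hS hx
  -- If g y lies in D, so do the images of all p - 1 nonzero F_p-multiples of y, and these lie in Y.
  obtain ⟨g, hg⟩ := exists_forall_smul_notMem (G := symplGroup p F n) (Y.subtype (· ≠ 0))
    (D.subtype (· ≠ 0)) (p - 1) (by
      rintro g ⟨y, hy, hgy⟩
      rw [Finset.mem_subtype] at hy hgy
      rw [hact] at hgy
      have hcard : Fintype.card {c : ZMod p // c ≠ 0} = p - 1 := by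
        rw [Fintype.card_subtype_compl, ZMod.card, Fintype.card_subtype_eq]
      rw [← hcard, ← Finset.card_univ]
      refine Finset.card_le_card_of_injOn (fun c => ⟨c.1 • y.1, smul_ne_zero c.2 y.2⟩)
        (fun c _ => ?_) (fun c _ c' _ h => ?_)
      · simp only [Finset.coe_filter, Set.mem_ofPred_eq, Finset.mem_subtype]
        rw [hact]
        exact ⟨hY c.1 c.2 _ hy, by rw [map_smul]; exact hD c.1 c.2 _ hgy⟩
      · exact Subtype.ext (smul_left_injective _ y.2 (congrArg Subtype.val h)))
    (by
      rw [hsub Y hY0, hsub D hD0]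
      rwa [Fintype.card_subtype_compl, Fintype.card_subtype_eq])
  refine ⟨g.1, g.2, fun y hy hgy => ?_⟩
  have hy0 : y ≠ 0 := fun h => hY0 (h ▸ hy)
  refine hg ⟨y, hy0⟩ (Finset.mem_subtype.2 hy) (Finset.mem_subtype.2 ?_)
  rw [hact]
  exact hgy

end Symplectic

/-! ### Counting vectors by symplectic weight -/

section Weight

variable {F : Type*} [Field F] {n : ℕ}

theorem swt_zero : swt (0 : Phase F n) = 0 := by
  simp [swt]

theorem swt_smul {p : ℕ} [Fact p.Prime] [Algebra (ZMod p) F] {c : ZMod p} (hc : c ≠ 0)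
    (w : Phase F n) : swt (c • w) = swt w := by
  classical
  rw [swt, swt]
  refine congrArg Finset.card (Finset.filter_congr fun i _ => not_congr ?_)
  simp only [Prod.smul_fst, Prod.smul_snd, Pi.smul_apply, Prod.mk.injEq]
  rw [smul_eq_zero_iff_right hc, smul_eq_zero_iff_right hc]

theorem swt_eq_zero_iff {w : Phase F n} : swt w = 0 ↔ w = 0 := by
  classical
  refine ⟨fun h => ?_, fun h => by rw [h, swt_zero]⟩
  rw [swt, Finset.card_eq_zero, Finset.filter_eq_empty_iff] at h
  have h' : ∀ i, (w.1 i, w.2 i) = (0, 0) := fun i => not_not.1 (h (Finset.mem_univ i))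
  exact Prod.ext (funext fun i => (Prod.ext_iff.1 (h' i)).1) (funext fun i => (Prod.ext_iff.1 (h' i)).2)

theorem card_swt_eq [Fintype F] [DecidableEq F] (j : ℕ) :
    (Finset.univ.filter fun w : Phase F n => swt w = j).card =
      n.choose j * (Fintype.card F ^ 2 - 1) ^ j := by
  classical
  let supp : (Fin n → F × F) → Finset (Fin n) := fun f => Finset.univ.filter fun i => f i ≠ 0
  have h1 : (Finset.univ.filter fun w : Phase F n => swt w = j).card =
      (Finset.univ.filter fun f : Fin n → F × F => (supp f).card = j).card := by
    refine Finset.card_equiv (Equiv.arrowProdEquivProdArrow (Fin n) (fun _ => F) (fun _ => F)).symm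
      fun w => ?_
    simp only [Finset.mem_filter, Finset.mem_univ, true_and]
    have : swt w = (supp ((Equiv.arrowProdEquivProdArrow (Fin n) (fun _ => F)
      (fun _ => F)).symm w)).card := by
      simp only [swt, supp]
      congr
    rw [this]
  rw [h1, Finset.card_eq_sum_card_fiberwise (f := supp)
    (t := Finset.powersetCard j Finset.univ) (fun f hf => by
      simpa [Finset.mem_powersetCard] using hf)]
  rw [Finset.sum_congr rfl (g := fun _ => (Fintype.card F ^ 2 - 1) ^ j), Finset.sum_const,
    Finset.card_powersetCard, Finset.card_univ, Fintype.card_fin, smul_eq_mul]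
  intro S hS
  rw [Finset.mem_powersetCard] at hS
  have : ((Finset.univ.filter fun f : Fin n → F × F => (supp f).card = j).filter
      fun f => supp f = S) =
      Fintype.piFinset fun i => if i ∈ S then Finset.univ.erase (0 : F × F) else {0} := by
    ext f
    simp only [Finset.mem_filter, Finset.mem_univ, true_and, Fintype.mem_piFinset]
    constructor
    · rintro ⟨_, rfl⟩ i
      by_cases h : f i = 0 <;> simp [supp, h]
    · intro h
      have hf : supp f = S := by
        ext i
        have := h i
        by_cases hi : i ∈ S
        · rw [if_pos hi] at this
          simpa [supp, hi] using this
        · rw [if_neg hi] at this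
          simpa [supp, hi] using this
      exact ⟨hf ▸ hS.2, hf⟩
  rw [this, Fintype.card_piFinset]
  have h2 : ∀ i, (if i ∈ S then Finset.univ.erase (0 : F × F) else {0}).card =
      if i ∈ S then Fintype.card F ^ 2 - 1 else 1 := by
    intro i
    split_ifs
    · rw [Finset.card_erase_of_mem (Finset.mem_univ _), Finset.card_univ, Fintype.card_prod, sq]
    · simp
  rw [Finset.prod_congr rfl fun i _ => h2 i, Finset.prod_ite_mem, Finset.univ_inter,
    Finset.prod_const, hS.2]

theorem card_swt_lt [Fintype F] [DecidableEq F] (d : ℕ) :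
    (Finset.univ.filter fun w : Phase F n => w ≠ 0 ∧ swt w < d).card =
      ∑ j ∈ Finset.Icc 1 (d - 1), n.choose j * (Fintype.card F ^ 2 - 1) ^ j := by
  rw [Finset.card_eq_sum_card_fiberwise (f := swt) (t := Finset.Icc 1 (d - 1))]
  · refine Finset.sum_congr rfl fun j hj => ?_
    rw [← card_swt_eq, Finset.filter_filter]
    congr 1
    ext w
    rw [Finset.mem_Icc] at hj
    simp only [Finset.mem_filter, Finset.mem_univ, true_and, and_iff_right_iff_imp]
    rintro rfl
    refine ⟨?_, by omega⟩
    rintro rfl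
    rw [swt_zero] at hj
    omega
  · intro w hw
    simp only [Finset.coe_filter, Finset.mem_univ, true_and, Set.mem_ofPred_eq] at hw
    have := Nat.pos_of_ne_zero (mt swt_eq_zero_iff.1 hw.1)
    simp only [Finset.coe_Icc, Set.mem_Icc]
    omega

end Weight

/-! ### Code triples and the Gilbert–Varshamov argument -/

section Triple

variable {p : ℕ} [Fact p.Prime] {F : Type*} [Field F] [Fintype F] [Algebra (ZMod p) F] {n : ℕ}

/-- `L` is isotropic and separates the points of `T`, and `Z ≤ L` is orthogonal to `T`; so `T ⊔ L`
is an additive code with isotropic subspace `L`, transversal `T` and radical containing `Z`. -/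
structure IsCodeTriple (T L Z : Submodule (ZMod p) (Phase F n)) : Prop where
  isotropic : Isotropic L
  separating : ∀ t ∈ T, (∀ l ∈ L, sympl p l t = 0) → t = 0
  le : Z ≤ L
  orthogonal : ∀ z ∈ Z, ∀ t ∈ T, sympl p z t = 0

theorem IsCodeTriple.map {T L Z : Submodule (ZMod p) (Phase F n)} (h : IsCodeTriple T L Z)
    {g : Phase F n ≃ₗ[ZMod p] Phase F n} (hg : g ∈ symplGroup p F n) :
    IsCodeTriple (T.map g.toLinearMap) (L.map g.toLinearMap) (Z.map g.toLinearMap) where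
  isotropic := by
    rintro _ ⟨u, hu, rfl⟩ _ ⟨v, hv, rfl⟩
    exact (hg u v).trans (h.isotropic u hu v hv)
  separating := by
    rintro _ ⟨t, ht, rfl⟩ hl
    have := h.separating t ht fun l hlL => (hg l t).symm.trans (hl _ ⟨l, hlL, rfl⟩)
    rw [this, map_zero]
  le := Submodule.map_mono h.le
  orthogonal := by
    rintro _ ⟨u, hu, rfl⟩ _ ⟨v, hv, rfl⟩
    exact (hg u v).trans (h.orthogonal u hu v hv)

theorem IsCodeTriple.sup_le {T L Z : Submodule (ZMod p) (Phase F n)} (h : IsCodeTriple T L Z) :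
    T ⊔ L ≤ (sympl p).orthogonal Z :=
  _root_.sup_le (fun t ht z hz => h.orthogonal z hz t ht)
    fun l hl z hz => h.isotropic z (h.le hz) l hl

theorem natCard_map_equiv {S : Submodule (ZMod p) (Phase F n)}
    (g : Phase F n ≃ₗ[ZMod p] Phase F n) : Nat.card (S.map g.toLinearMap) = Nat.card S :=
  Nat.card_congr (g.submoduleMap S).symm.toEquiv

theorem exists_submodule_le_finrank_eq {K V : Type*} [DivisionRing K] [AddCommGroup V] [Module K V]
    (S : Submodule K V) [Module.Finite K S] {m : ℕ} (hm : m ≤ Module.finrank K S) :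
    ∃ S' ≤ S, Module.finrank K S' = m := by
  obtain ⟨f, hf⟩ := exists_linearIndependent_of_le_finrank hm
  refine ⟨(Submodule.span K (Set.range f)).map S.subtype, Submodule.map_subtype_le _ _, ?_⟩
  rw [Submodule.finrank_map_subtype_eq, finrank_span_eq_card hf, Fintype.card_fin]

theorem natCard_submodule {V : Type*} [AddCommGroup V] [Module (ZMod p) V] [Finite V]
    (S : Submodule (ZMod p) V) : Nat.card S = p ^ Module.finrank (ZMod p) S := by
  rw [Module.natCard_eq_pow_finrank (K := ZMod p), Nat.card_zmod]

theorem natCard_submodule_prod {V W : Type*} [AddCommGroup V] [Module (ZMod p) V] [Finite V]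
    [AddCommGroup W] [Module (ZMod p) W] [Finite W]
    (S : Submodule (ZMod p) V) (S' : Submodule (ZMod p) W) : Nat.card (S.prod S') =
      p ^ (Module.finrank (ZMod p) S + Module.finrank (ZMod p) S') := by
  rw [pow_add, ← natCard_submodule, ← natCard_submodule, ← Nat.card_prod]
  exact Nat.card_congr (Equiv.Set.prod (S : Set V) (S' : Set W))

/-- Let S₁ ≤ S₂ in F^n have dimensions s and s + t. Place S₂ and S₁ in the Z-type coordinates as L
and Z, and let T be a complement of S₂^⊥ in S₁^⊥, placed in the X-type coordinates. Then T is
orthogonal to Z, and no nonzero vector of it is orthogonal to L. -/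
theorem exists_isCodeTriple (p : ℕ) [Fact p.Prime] (F : Type*) [Field F] [Fintype F]
    [Algebra (ZMod p) F] (n : ℕ) {s t : ℕ}
    (hst : s + t ≤ Module.finrank (ZMod p) (Fin n → F)) :
    ∃ T L Z : Submodule (ZMod p) (Phase F n), IsCodeTriple T L Z ∧
      Nat.card T = p ^ t ∧ Nat.card L = p ^ (s + t) ∧
      Nat.card (T ⊔ L : Submodule (ZMod p) (Phase F n)) = p ^ (s + 2 * t) ∧
      Nat.card ((sympl p).orthogonal Z) = p ^ (2 * Module.finrank (ZMod p) (Fin n → F) - s) := by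
  have hS : ∃ S₂ : Submodule (ZMod p) (Fin n → F), Module.finrank (ZMod p) S₂ = s + t := by
    obtain ⟨S₂, -, h⟩ := exists_submodule_le_finrank_eq (⊤ : Submodule (ZMod p) (Fin n → F))
      (hst.trans_eq (finrank_top _ _).symm)
    exact ⟨S₂, h⟩
  obtain ⟨S₂, hS₂⟩ := hS
  obtain ⟨S₁, hle, hS₁⟩ := exists_submodule_le_finrank_eq S₂ (hS₂ ▸ Nat.le_add_right s t)
  set B : LinearMap.BilinForm (ZMod p) (Fin n → F) := traceDot p
  have hB : B.Nondegenerate := traceDot_nondegenerate p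
  have hle' : B.orthogonal S₂ ≤ B.orthogonal S₁ := LinearMap.BilinForm.orthogonal_le hle
  obtain ⟨T₁, hdisj, hsup⟩ := IsModularLattice.exists_disjoint_and_sup_eq hle'
  have hrank₁ := LinearMap.BilinForm.finrank_orthogonal hB S₁
  have hrank₂ := LinearMap.BilinForm.finrank_orthogonal hB S₂
  have hT₁ : Module.finrank (ZMod p) T₁ = t := by
    have := Submodule.finrank_sup_add_finrank_inf_eq (B.orthogonal S₂) T₁
    rw [hsup, hdisj.eq_bot, finrank_bot] at this
    omega
  have hsympl : ∀ (b : Fin n → F) (w : Phase F n), sympl p (0, b) w = B b w.1 := fun b w => by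
    rw [sympl_apply, map_zero, LinearMap.zero_apply, sub_zero]
  refine ⟨T₁.prod ⊥, Submodule.prod ⊥ S₂, Submodule.prod ⊥ S₁, ⟨?_, ?_, ?_, ?_⟩, ?_, ?_, ?_, ?_⟩
  · rintro ⟨a, b⟩ ⟨ha, -⟩ ⟨a', b'⟩ ⟨ha', -⟩
    obtain rfl : a = 0 := ha
    obtain rfl : a' = 0 := ha'
    rw [hsympl, map_zero]
  · rintro ⟨a, b⟩ ⟨ha, hb⟩ h
    obtain rfl : b = 0 := hb
    have : a ∈ B.orthogonal S₂ := fun c hc =>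
      (hsympl c (a, 0)).symm.trans (h (0, c) ⟨Submodule.zero_mem _, hc⟩)
    rw [Submodule.disjoint_def.1 hdisj a this ha]
    rfl
  · exact Submodule.prod_mono le_rfl hle
  · rintro ⟨a, b⟩ ⟨ha, hb⟩ ⟨a', b'⟩ ⟨ha', -⟩
    obtain rfl : a = 0 := ha
    have h1 : a' ∈ B.orthogonal S₁ := hsup ▸ Submodule.mem_sup_right ha'
    exact (hsympl b _).trans (h1 b hb)
  · rw [natCard_submodule_prod, finrank_bot, hT₁, add_zero]
  · rw [natCard_submodule_prod, finrank_bot, hS₂, zero_add]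
  · rw [Submodule.prod_sup_prod, sup_bot_eq, bot_sup_eq, natCard_submodule_prod, hT₁, hS₂]
    congr 1
    ring
  · have : (sympl p).orthogonal (Submodule.prod ⊥ S₁) = (B.orthogonal S₁).prod ⊤ := by
      ext ⟨a, b⟩
      refine ⟨fun h => ⟨fun c hc => ?_, Submodule.mem_top⟩, ?_⟩
      · exact (hsympl c (a, b)).symm.trans (h (0, c) ⟨Submodule.zero_mem _, hc⟩)
      · rintro ⟨h, -⟩ ⟨a', b'⟩ ⟨ha', hb'⟩
        obtain rfl : a' = 0 := ha'
        exact (hsympl b' (a, b)).trans (h b' hb')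
    rw [this, natCard_submodule_prod, hrank₁, hS₁, finrank_top]
    congr 1
    omega

/-- The Gilbert–Varshamov argument for additive codes. -/
theorem exists_isCodeTriple_forall_mem (p : ℕ) [Fact p.Prime] (F : Type*) [Field F] [Fintype F]
    [Algebra (ZMod p) F] (n : ℕ) {s t d : ℕ}
    (hst : s + t ≤ Module.finrank (ZMod p) (Fin n → F))
    (hlt : (p ^ (2 * Module.finrank (ZMod p) (Fin n → F) - s) - p ^ (s + 2 * t)) *
      ∑ j ∈ Finset.Icc 1 (d - 1), n.choose j * (Fintype.card F ^ 2 - 1) ^ j <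
        (p - 1) * (Fintype.card F ^ (2 * n) - 1)) :
    ∃ T L Z : Submodule (ZMod p) (Phase F n), IsCodeTriple T L Z ∧
      Nat.card T = p ^ t ∧ Nat.card L = p ^ (s + t) ∧
      Nat.card (T ⊔ L : Submodule (ZMod p) (Phase F n)) = p ^ (s + 2 * t) ∧
      ∀ w : Phase F n, swt w < d → (∀ z ∈ Z, sympl p z w = 0) → w ∈ T ⊔ L := by
  classical
  obtain ⟨T, L, Z, h, hT, hL, hTL, hZ⟩ := exists_isCodeTriple p F n hst
  -- The bad vectors: errors that commute with Z but lie outside X = T ⊔ L.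
  let Y : Finset (Phase F n) :=
    (Finset.univ.filter (· ∈ (sympl p).orthogonal Z)) \ (Finset.univ.filter (· ∈ T ⊔ L))
  have hYmem : ∀ y, y ∈ Y ↔ y ∈ (sympl p).orthogonal Z ∧ y ∉ T ⊔ L := fun y => by simp [Y]
  have hYcard : Y.card =
      p ^ (2 * Module.finrank (ZMod p) (Fin n → F) - s) - p ^ (s + 2 * t) := by
    have hc : ∀ S : Submodule (ZMod p) (Phase F n),
        (Finset.univ.filter (· ∈ S)).card = Nat.card S := fun S => by
      rw [Nat.card_eq_fintype_card, Fintype.card_subtype]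
    rw [Finset.card_sdiff_of_subset (Finset.monotone_filter_right _ fun y _ hy => h.sup_le hy),
      hc, hc, hZ, hTL]
  obtain ⟨g, hg, hgY⟩ := exists_symplGroup_forall_notMem (p := p) Y
    (Finset.univ.filter fun w : Phase F n => w ≠ 0 ∧ swt w < d)
    (fun h0 => ((hYmem 0).1 h0).2 (Submodule.zero_mem _)) (by simp)
    (fun c hc y hy => by
      rw [hYmem] at hy ⊢
      exact ⟨Submodule.smul_mem _ c hy.1, mt (Submodule.smul_mem_iff _ hc).1 hy.2⟩)
    (fun c hc y hy => by
      simp only [Finset.mem_filter, Finset.mem_univ, true_and] at hy ⊢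
      exact ⟨smul_ne_zero hc hy.1, by rw [swt_smul hc]; exact hy.2⟩)
    (by
      have hcard : Fintype.card (Phase F n) = Fintype.card F ^ (2 * n) := by
        rw [Fintype.card_prod, Fintype.card_fun, Fintype.card_fin, ← pow_add, two_mul]
      rw [hYcard, card_swt_lt, hcard]
      exact hlt)
  refine ⟨_, _, _, h.map hg, by rw [natCard_map_equiv, hT], by rw [natCard_map_equiv, hL],
    by rw [← Submodule.map_sup, natCard_map_equiv, hTL], fun w hw hwZ => ?_⟩
  rw [← Submodule.map_sup]
  obtain ⟨y, rfl⟩ := g.surjective w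
  by_contra hy
  have hy' : y ∉ T ⊔ L := fun h' => hy ⟨y, h', rfl⟩
  refine hgY y ((hYmem y).2 ⟨fun z hz => ?_, hy'⟩) ?_
  · exact (hg z y).symm.trans (hwZ (g z) ⟨z, hz, rfl⟩)
  · simp only [Finset.mem_filter, Finset.mem_univ, true_and]
    refine ⟨fun h0 => hy (h0 ▸ Submodule.zero_mem _), hw⟩

end Triple

/-! ### Numerical consequences of the inequality -/

section Existence

variable {p : ℕ} [Fact p.Prime] {F : Type*} [Field F] [Fintype F] [Algebra (ZMod p) F]

theorem card_eq_pow_finrank (p : ℕ) [Fact p.Prime] (F : Type*) [Field F] [Fintype F]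
    [Algebra (ZMod p) F] : Fintype.card F = p ^ Module.finrank (ZMod p) F := by
  rw [Module.card_eq_pow_finrank (K := ZMod p), ZMod.card]

theorem finrank_pi_field (p : ℕ) [Fact p.Prime] (F : Type*) [Field F] [Fintype F]
    [Algebra (ZMod p) F] (n : ℕ) :
    Module.finrank (ZMod p) (Fin n → F) = Module.finrank (ZMod p) F * n := by
  rw [Module.finrank_pi_fintype, Finset.sum_const, Finset.card_univ, Fintype.card_fin, smul_eq_mul,
    mul_comm]

/-- The hypothesis of the Gilbert–Varshamov argument, from an inequality of real numbers. -/
theorem gv_hypothesis_of_real {m n r a S : ℕ} (hp : 1 ≤ p) (ha : a + m * r ≤ m * n)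
    (h : ((p ^ m : ℝ) ^ (n + r) * p ^ a - (p ^ m : ℝ) ^ (n + r) / p ^ a) * S <
      ((p : ℝ) - 1) * ((p ^ m : ℝ) ^ (2 * n) - 1)) :
    (p ^ (2 * (m * n) - (m * n - (a + m * r))) - p ^ ((m * n - (a + m * r)) + 2 * (m * r))) * S <
      (p - 1) * ((p ^ m) ^ (2 * n) - 1) := by
  -- Here c is the parameter s of the triple; it turns the truncated subtractions into sums.
  obtain ⟨c, hc⟩ := Nat.exists_eq_add_of_le ha
  have e1 : 2 * (m * n) - (m * n - (a + m * r)) = m * (n + r) + a := by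
    rw [mul_add]; omega
  have e2 : (m * n - (a + m * r)) + 2 * (m * r) = c + 2 * (m * r) := by omega
  have e3 : m * (n + r) = c + 2 * (m * r) + a := by rw [mul_add]; omega
  have hp0 : (p : ℝ) ≠ 0 := by positivity
  rw [e1, e2]
  have hle : p ^ (c + 2 * (m * r)) ≤ p ^ (m * (n + r) + a) :=
    Nat.pow_le_pow_right hp (by omega)
  have hle2 : 1 ≤ (p ^ m) ^ (2 * n) := Nat.one_le_pow _ _ (Nat.pow_pos hp)
  rw [← Nat.cast_lt (α := ℝ)]
  push_cast [Nat.cast_sub hle, Nat.cast_sub hle2, Nat.cast_sub hp]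
  have h1 : (p ^ m : ℝ) ^ (n + r) / p ^ a = p ^ (c + 2 * (m * r)) := by
    rw [← pow_mul, e3, pow_add _ _ a, mul_div_cancel_right₀ _ (pow_ne_zero _ hp0)]
  rw [h1, ← pow_mul, ← pow_add] at h
  exact h

/-- The term j = 1 alone gains (n - n') x ≥ x. This slack is what shortening the code uses up. -/
theorem sum_choose_add_le {n' n d x : ℕ} (hn : n' < n) (hd : 2 ≤ d) :
    (∑ j ∈ Finset.Icc 1 (d - 1), n'.choose j * x ^ j) + x ≤
      ∑ j ∈ Finset.Icc 1 (d - 1), n.choose j * x ^ j := by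
  have h1 : 1 ∈ Finset.Icc 1 (d - 1) := Finset.mem_Icc.2 ⟨le_rfl, by omega⟩
  rw [← Finset.add_sum_erase _ _ h1, ← Finset.add_sum_erase _ (fun j => n.choose j * x ^ j) h1,
    add_right_comm]
  refine add_le_add ?_ (Finset.sum_le_sum fun j _ =>
    Nat.mul_le_mul_right _ (Nat.choose_le_choose j hn.le))
  simp only [Nat.choose_one_right, pow_one]
  calc n' * x + x = (n' + 1) * x := by ring
    _ ≤ n * x := Nat.mul_le_mul_right _ hn

/-- The Gilbert–Varshamov inequality forces `q^r K < p q^n`. -/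
theorem mul_le_of_gv {x y K P S : ℝ} (hx : 1 ≤ x) (hK : 2 ≤ K) (hP : 1 ≤ P) (hS : 3 ≤ S)
    (h : (x * y * K - x * y / K) * S < (P - 1) * (x ^ 2 - 1)) : y * K < P * x := by
  by_contra! hle
  have hy : 0 < y := by
    by_contra! hy
    nlinarith
  -- As K ≥ 2, the difference retains 3/4 of its first term. If y K ≥ P x, the left side is then at
  -- least (9/4) P x², too large.
  have h1 : x * y / K ≤ x * y * K / 4 := by
    rw [div_le_div_iff₀ (by linarith) (by norm_num)]
    have : 0 ≤ x * y := by positivity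
    nlinarith [mul_nonneg this (by nlinarith : (0 : ℝ) ≤ K * K - 4)]
  have h2 : P * x ^ 2 ≤ x * y * K := by nlinarith
  have h3 : 3 / 4 * (P * x ^ 2) ≤ x * y * K - x * y / K := by linarith
  have h4 : 0 ≤ P * x ^ 2 := by positivity
  have h5 : 3 / 4 * (P * x ^ 2) * 3 ≤ (x * y * K - x * y / K) * S :=
    mul_le_mul h3 hS (by norm_num) (by linarith)
  nlinarith

/-- Dividing by y² leaves D S < (P - 1) x² with D = x K - x / K. Since S exceeds S' by at least P -
1 and D ≥ 1, the surplus D (P - 1) pays for the missing -1 on the right. -/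
theorem gv_shorten {x y K P S S' : ℝ} (hx : 1 ≤ x) (hy : 1 ≤ y) (hK : 2 ≤ K) (hP : 1 ≤ P)
    (hS : S' + (P - 1) ≤ S)
    (h : (x * y * y * K - x * y * y / K) * S < (P - 1) * ((x * y) ^ 2 - 1)) :
    (x * K - x / K) * S' < (P - 1) * (x ^ 2 - 1) := by
  have hD : 1 ≤ x * K - x / K := by
    have : x / K ≤ x / 2 := div_le_div_of_nonneg_left (by linarith) (by norm_num) hK
    nlinarith
  set D := x * K - x / K
  have e : x * y * y * K - x * y * y / K = y ^ 2 * D := by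
    simp only [D]; ring
  rw [e] at h
  have hy2 : 0 < y ^ 2 := by positivity
  have h1 : y ^ 2 * (D * S) < y ^ 2 * ((P - 1) * x ^ 2) := by nlinarith
  have h2 := lt_of_mul_lt_mul_left h1 hy2.le
  have h3 : D * (S' + (P - 1)) ≤ D * S := mul_le_mul_of_nonneg_left hS (by linarith)
  nlinarith

end Existence

end SubsystemCode

end

/-! ### The two codes -/

open SubsystemCode in
theorem mainTheorem7 (p : ℕ) [Fact p.Prime]
    {F : Type*} [Field F] [Fintype F] [Algebra (ZMod p) F]
    (q : ℕ) (hq : q = Fintype.card F)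
    (n r d K : ℕ) (k : ℝ)
    (hk : (q : ℝ) ^ k = (K : ℝ)) (hKp : ∃ a : ℕ, K = p ^ a)
    (hk_lower : 1 < (q : ℝ) ^ k) (hk_upper : (q : ℝ) ^ k ≤ (q : ℝ) ^ n)
    (hr : 0 < r) (hrn : r < n) (hd : 1 ≤ d)
    (hd_one : d = 1 → k + r ≤ n)
    (hineq :
      (∑ j ∈ Finset.Icc 1 (d - 1), (n.choose j : ℝ) * ((q : ℝ) ^ 2 - 1) ^ j) *
          ((q : ℝ) ^ ((n : ℝ) + k + r) - (q : ℝ) ^ ((n : ℝ) + r - k)) <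
        ((p : ℝ) - 1) * ((q : ℝ) ^ (2 * n) - 1)) :
    (∃ Q : Code F n K (q ^ r), Q.IsClifford p ∧ Q.MinDistGE p d) ∧
    (∃ Q : Submodule ℂ (Qudits F (n - r)),
      IsStabilizerCode p Q ∧ Module.finrank ℂ Q = K ∧ StabilizerMinDistGE p Q d) := by
  obtain ⟨a, rfl⟩ := hKp
  have hp : p.Prime := Fact.out
  set m := Module.finrank (ZMod p) F with hm
  have hqm : Fintype.card F = p ^ m := card_eq_pow_finrank p F
  obtain rfl : q = p ^ m := hq.trans hqm
  have hmpos : 0 < m := Module.finrank_pos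
  have hq2 : 2 ≤ p ^ m := hp.two_le.trans (Nat.le_self_pow hmpos.ne' p)
  have hqR : (1 : ℝ) ≤ ((p ^ m : ℕ) : ℝ) := by exact_mod_cast (one_le_two.trans hq2)
  have hq0 : (0 : ℝ) < ((p ^ m : ℕ) : ℝ) := by linarith
  have hK2 : (2 : ℝ) ≤ ((p ^ a : ℕ) : ℝ) := by
    rw [hk] at hk_lower
    exact_mod_cast hk_lower
  have hpR : (1 : ℝ) ≤ p := by exact_mod_cast hp.one_le
  let S : ℕ → ℕ := fun n => ∑ j ∈ Finset.Icc 1 (d - 1), n.choose j * ((p ^ m) ^ 2 - 1) ^ j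
  have hScast : (∑ j ∈ Finset.Icc 1 (d - 1), (n.choose j : ℝ) * (((p ^ m : ℕ) : ℝ) ^ 2 - 1) ^ j) =
      ((S n : ℕ) : ℝ) := by
    have : 1 ≤ (p ^ m) ^ 2 := Nat.one_le_pow _ _ (by omega)
    simp only [S, Nat.cast_sum, Nat.cast_mul, Nat.cast_pow, Nat.cast_sub this, Nat.cast_one]
  have hrp : ∀ i : ℕ, ((p ^ m : ℕ) : ℝ) ^ (i : ℝ) = ((p ^ m : ℕ) : ℝ) ^ i :=
    fun i => Real.rpow_natCast _ i
  rw [hScast, Real.rpow_sub hq0, Real.rpow_add hq0, Real.rpow_add hq0, Real.rpow_add hq0, hk, hrp,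
    hrp, mul_right_comm] at hineq
  set x : ℝ := ((p ^ m : ℕ) : ℝ) ^ (n - r) with hxdef
  set y : ℝ := ((p ^ m : ℕ) : ℝ) ^ r with hydef
  have hx : 1 ≤ x := one_le_pow₀ hqR
  have hy : 1 ≤ y := one_le_pow₀ hqR
  have hxy : ((p ^ m : ℕ) : ℝ) ^ n = x * y := by
    rw [hxdef, hydef, ← pow_add, Nat.sub_add_cancel hrn.le]
  rw [pow_mul', hxy, mul_comm] at hineq
  -- This is q^r K ≤ q^n, needed for s ≥ 0. For d ≥ 2 the inequality gives q^r K < p q^n, and both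
  -- sides are powers of p.
  have hbound : a + m * r ≤ m * n := by
    rcases hd.eq_or_lt with hd1 | hd2
    · have h1 := Real.rpow_le_rpow_of_exponent_le hqR (hd_one hd1.symm)
      rw [Real.rpow_add hq0, hk, hrp, hrp] at h1
      have h2 : p ^ a * (p ^ m) ^ r ≤ (p ^ m) ^ n := by exact_mod_cast h1
      rw [← pow_mul, ← pow_mul, ← pow_add] at h2
      exact (Nat.pow_le_pow_iff_right hp.one_lt).1 h2
    · have hS3 : (3 : ℝ) ≤ S n := by
        have h1 := sum_choose_add_le (x := (p ^ m) ^ 2 - 1) (d := d) (Nat.zero_lt_of_lt hrn) hd2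
        have h2 : 3 ≤ (p ^ m) ^ 2 - 1 := by
          have := Nat.pow_le_pow_left hq2 2
          omega
        exact_mod_cast h2.trans ((Nat.le_add_left _ _).trans h1)
      have h1 := mul_le_of_gv (one_le_mul_of_one_le_of_one_le hx hy) hK2 hpR hS3 hineq
      rw [← hxy, hydef] at h1
      have h2 : (p ^ m) ^ r * p ^ a < p * (p ^ m) ^ n := by exact_mod_cast h1
      rw [← pow_mul, ← pow_mul, ← pow_add, ← pow_succ'] at h2
      have := (Nat.pow_lt_pow_iff_right hp.one_lt).1 h2
      omega
  constructor
  -- With these parameters |T| = q^r and |L| = q^n / K. The set Z^⊥ \ X has q^(n+r) K - q^(n+r) / K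
  -- elements.
  · obtain ⟨T, L, Z, h, hT, hL, hTL, hw⟩ := exists_isCodeTriple_forall_mem p F n
      (s := m * n - (a + m * r)) (t := m * r) (d := d)
      (by rw [finrank_pi_field, ← hm]; omega)
      (by
        rw [finrank_pi_field, ← hm, hqm]
        refine gv_hypothesis_of_real hp.one_le hbound ?_
        rw [← Nat.cast_pow p m, ← Nat.cast_pow p a, pow_add, pow_mul', hxy]
        exact hineq)
    refine exists_clifford_code h.isotropic h.separating h.le h.orthogonal ?_ (Nat.pow_pos hp.pos)
      ?_ (hT.trans (pow_mul p m r)) hw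
    · intro hbot
      have h1 := Nat.one_lt_pow (n := (m * n - (a + m * r)) + 2 * (m * r))
        (by have := Nat.mul_pos hmpos hr; omega) hp.one_lt
      rw [← hTL, hbot, Nat.card_unique] at h1
      exact lt_irrefl _ h1
    · rw [hL, hqm, ← pow_add, ← pow_mul]
      congr 1
      omega
  · have hmr : m * (n - r) = m * n - m * r := Nat.mul_sub m n r
    have hbound' : a + m * 0 ≤ m * (n - r) := by omega
    obtain ⟨T, L, Z, h, hT, hL, -, hw⟩ := exists_isCodeTriple_forall_mem p F (n - r)
      (s := m * (n - r) - (a + m * 0)) (t := m * 0) (d := d)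
      (by rw [finrank_pi_field, ← hm]; omega)
      (by
        rw [finrank_pi_field, ← hm, hqm]
        refine gv_hypothesis_of_real hp.one_le hbound' ?_
        rw [← Nat.cast_pow p m, ← Nat.cast_pow p a, add_zero, pow_mul', ← hxdef]
        change _ * ((S (n - r) : ℕ) : ℝ) < _
        -- For d = 1 the sum is empty, and the right side is positive because n - r > 0.
        rcases hd.eq_or_lt with hd1 | hd2
        · have hS0 : S (n - r) = 0 := by simp [S, ← hd1]
          have hp1 : (1 : ℝ) < p := by exact_mod_cast hp.one_lt
          have hx1 : 1 < x := one_lt_pow₀ (by exact_mod_cast hq2) (by omega)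
          rw [hS0, Nat.cast_zero, mul_zero]
          exact mul_pos (by linarith) (sub_pos.2 (one_lt_pow₀ hx1 two_ne_zero))
        · refine gv_shorten hx hy hK2 hpR (S := S n) ?_ hineq
          have h1 := sum_choose_add_le (x := (p ^ m) ^ 2 - 1) (d := d) (Nat.sub_lt (by omega) hr :
            n - r < n) hd2
          have h2 : p - 1 ≤ (p ^ m) ^ 2 - 1 := by
            rw [← pow_mul]
            exact Nat.sub_le_sub_right (Nat.le_self_pow (by omega) p) 1
          have h3 : S (n - r) + (p - 1) ≤ S n := (Nat.add_le_add_left h2 _).trans h1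
          rw [← Nat.cast_one, ← Nat.cast_sub hp.one_le]
          exact_mod_cast h3)
    -- With t = 0, X reduces to L. Low-weight errors commuting with L commute with Z ≤ L, so they
    -- lie in L.
    have hT0 : T = ⊥ := by
      rw [mul_zero, pow_zero] at hT
      exact (Submodule.eq_bot_iff T).2 fun t ht =>
        congrArg Subtype.val ((Nat.card_eq_one_iff_unique.1 hT).1.elim (⟨t, ht⟩ : T) 0)
    rw [hT0, bot_sup_eq] at hw
    refine exists_stabilizer_code h.isotropic ?_ fun w hwd hwL =>
      hw w hwd fun z hz => hwL z (h.le hz)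
    rw [hL, hqm, ← pow_add, ← pow_mul]
    congr 1
    omega
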